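/- Let $n\ge 2$ be an integer, let $\|\cdot\|$ be the operator norm on $\mathbb{M}_n(\mathbb{C})$ (with $\mathbb{C}^n$ carrying its Euclidean norm), and let $\mathcal{T}_n\subseteq\mathbb{M}_n(\mathbb{C})$ be the set of strictly upper triangular matrices. A projection is a matrix $Q$ with $Q=Q^2=Q^*$. Put $\mathrm{dist}(A,\mathcal{T}_n)=\inf_{T\in\mathcal{T}_n}\|A-T\|$ and $$\nu_{n-1,n}=\inf\{\|P-N\| : P\in\mathbb{M}_n(\mathbb{C})\text{ a projection of rank } n-1,\ N\in\mathbb{M}_n(\mathbb{C})\text{ nilpotent}\}.$$ Let $t=\nu_{n-1,n}^2$, $h_t(x)=\dfrac{-t^2+2tx+t-x}{tx+t-x}$, $a_0=0$ and $a_k=h_t(a_{k-1})$ for $1\le k\le n$. These numbers are well defined (no denominator $ta_{k-1}+t-a_{k-1}$, $1\le k\le n$, vanishes) and $a_0\le a_1\le\dots\le a_n$. For complex numbers $z_1,\dots,z_n$ of modulus $1$ let $$e=\bigl(z_1\sqrt{a_1-a_0},\ z_2\sqrt{a_2-a_1},\ \dots,\ z_n\sqrt{a_n-a_{n-1}}\bigr)^T,\qquad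 Q_z=I-e\otimes e^*,$$ where $e\otimes e^*$ is the matrix with entries $e_i\overline{e_j}$. (i) For all such $z$, $Q_z$ is a projection of rank $n-1$ and $\mathrm{dist}(Q_z,\mathcal{T}_n)=\nu_{n-1,n}$. Moreover, a matrix $Q$ is a projection of rank $n-1$ whose distance to $\mathcal{T}_n$ is minimal among all projections of rank $n-1$ if and only if $Q=Q_z$ for some such $z$. (ii) For all such $z$, writing $Q=Q_z$, there is a unique $T\in\mathcal{T}_n$ with $\|Q-T\|=\mathrm{dist}(Q,\mathcal{T}_n)$, and $Q-T=\nu_{n-1,n}U$ for some unitary $U$. If $q_k,t_k$ denote the $k$-th columns of $Q,T$, then the columns $t_k$ are determined iteratively by linear equations: $t_1=0$, and for $2\le k\le n$, $t_k$ is the unique vector $v\in\mathbb{C}^n$ whose $i$-th entry is $0$ for all $i\ge k$ and which satisfies $$\langle q_j-t_j,\ q_k-v\rangle=0\qquad\text{for } j=1,\dots,k-1.$$ (iii) Any two closest projection–nilpotent pairs are unitarily equivalent: if $Q,Q'$ are projections of rank $n-1$ and $N,N'$ are nilpotent matrices in $\mathbb{M}_n(\mathbb{C})$ with $\|Q-N\|=\|Q'-N'\|=\nu_{n-1,n}$,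 then there is a unitary $V$ with $Q'=V^*QV$ and $N'=V^*NV$. -/

import Mathlib

open scoped Matrix Matrix.Norms.L2Operator

namespace ProjNil

noncomputable section

/-- `n × n` complex matrices; with the scoped instances opened above, `‖A‖` is the operator norm
of `A` on `ℂⁿ` with its Euclidean norm. -/
abbrev Mat (n : ℕ) := Matrix (Fin n) (Fin n) ℂ

/-- `Q` is an orthogonal projection (`Q = Q² = Q*`) of rank `r`. -/
def IsProjOfRank (n r : ℕ) (Q : Mat n) : Prop :=
  IsStarProjection Q ∧ Q.rank = r

/-- The algebra of strictly upper triangular matrices. -/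
def strictUpper (n : ℕ) : Set (Mat n) :=
  {T | ∀ i j : Fin n, j ≤ i → T i j = 0}

/-- `ν_{r,n}` (for `1 ≤ r ≤ n`): the infimum of `‖P - N‖` over all projections `P` of rank `r` and
all nilpotent `N`. -/
def nu (r n : ℕ) : ℝ :=
  sInf {d : ℝ | ∃ P N : Mat n, IsProjOfRank n r P ∧ IsNilpotent N ∧ d = ‖P - N‖}

/-- The distance from `A` to the strictly upper triangular matrices. -/
def distT (n : ℕ) (A : Mat n) : ℝ :=
  Metric.infDist A (strictUpper n)

/-- `Q` is a projection of rank `n - 1` whose distance to the strictly upper triangular matrices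
is minimal among all projections of rank `n - 1`. -/
def IsClosestProj (n : ℕ) (Q : Mat n) : Prop :=
  IsProjOfRank n (n - 1) Q ∧ ∀ Q' : Mat n, IsProjOfRank n (n - 1) Q' → distT n Q ≤ distT n Q'

/-- `T` is a strictly upper triangular matrix nearest to `A`. -/
def IsNearest (n : ℕ) (A T : Mat n) : Prop :=
  T ∈ strictUpper n ∧ ‖A - T‖ = distT n A

/-- `(Q, N)` is a closest pair consisting of a projection of rank `n - 1` and a nilpotent. -/
def IsClosestPair (n : ℕ) (Q N : Mat n) : Prop :=
  IsProjOfRank n (n - 1) Q ∧ IsNilpotent N ∧ ‖Q - N‖ = nu (n - 1) n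

/-- The denominator of `h_t(x)`. -/
def hDen (t x : ℝ) : ℝ := t * x + t - x

/-- `h_t(x) = (-t² + 2tx + t - x) / (tx + t - x)`. -/
def h (t x : ℝ) : ℝ := (-t ^ 2 + 2 * t * x + t - x) / hDen t x

/-- The iterates `a_0 = 0`, `a_k = h_t(a_{k-1})`. -/
def aSeq (t : ℝ) : ℕ → ℝ
  | 0 => 0
  | k + 1 => h t (aSeq t k)

/-- The sequence `a_0, a_1, …` for `t = ν_{n-1,n}²`. -/
def a (n : ℕ) : ℕ → ℝ := aSeq (nu (n - 1) n ^ 2)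

/-- The vector `e` with entries `z_i √(a_i - a_{i-1})`, `1 ≤ i ≤ n` (here indexed from `0`). -/
def eVec (n : ℕ) (z : Fin n → ℂ) : Fin n → ℂ :=
  fun i => z i * (Real.sqrt (a n (i + 1) - a n i) : ℂ)

/-- `Q = I - e ⊗ e*`, whose entries are `δ_{ij} - e_i * conj e_j`. -/
def optQ (n : ℕ) (z : Fin n → ℂ) : Mat n :=
  1 - Matrix.vecMulVec (eVec n z) (star (eVec n z))

end

end ProjNil

namespace ProjNil

/-! ### The Möbius maps `h t` and their iterates -/

/-! Schur triangularization of the nilpotent reduces the problem to the distance from `I - e e*`,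
with `e` a unit vector, to the strictly upper triangular matrices. Index from 0, let `x_k` be the
sum of `|e_i|²` over `i < k`, and let `A = I - e e* - T` with `‖A‖² ≤ t`. On and below the diagonal
`A` does not depend on `T`, so if `v` is supported on coordinates `≤ k`, the rows `≥ k` of `A v` are
known. Testing `‖A v‖² ≤ t ‖v‖²` on the best such `v` (`AgreesBelow.sum_top_le_slack`) gives
`h_t(x_k) ≤ x_{k+1}`. Since `h_t` is increasing, the orbit `a_k` of `0` satisfies `a_k ≤ x_k`, and
`x_n = 1` forces `x_{n-1} ≤ t`.

Conversely, if the orbit stays below `t`, a vector `e` with `x_k = a_k` for `k < n` admits an `A`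
with orthogonal columns of squared norm at most `t` (`AgreesBelow.exists_next_col`,
`exists_orthogonal_cols`). If moreover `a_{n-1} < t`, continuity allows a smaller `t`; hence
`a_{n-1} = t` at `t = ν²` (`a_pred_last`).

Everything is then rigid. Strict monotonicity of `h_t` forces `x_k = a_k`, which fixes the moduli of
`e`. Every inequality above is an equality, so each column of `A` is determined by the earlier ones,
and the constructed scaled unitary is the only optimal `A`. Only the phases of `e` remain free, and
a diagonal unitary removes them. -/

lemma hDen_nonneg {t x : ℝ} (ht : 1 / 2 ≤ t) (hx0 : 0 ≤ x) (hx : x ≤ 1) : 0 ≤ hDen t x := by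
  unfold hDen; nlinarith

lemma hDen_pos {t x : ℝ} (ht : 1 / 2 ≤ t) (hx0 : 0 ≤ x) (hx : x < 1) : 0 < hDen t x := by
  unfold hDen; nlinarith

/-- The factor `x² - x + t` has no real root for `t > 1/4`, so `h t` has no real fixed point other
than in the degenerate case `t = 1`. -/
lemma h_sub_self {t x : ℝ} (hd : hDen t x ≠ 0) :
    (h t x - x) * hDen t x = (1 - t) * (x ^ 2 - x + t) := by
  have : h t x * hDen t x = -t ^ 2 + 2 * t * x + t - x := div_mul_cancel₀ _ hd
  rw [sub_mul, this]; unfold hDen; ring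

/-- Where the denominator is positive and `t > 0`, `h t x ≤ 1` means `x ≤ t`, and `h t` sends `t` to
`1`: this is the terminal condition on the orbit. -/
lemma one_sub_h {t x : ℝ} (hd : hDen t x ≠ 0) : (1 - h t x) * hDen t x = t * (t - x) := by
  have : h t x * hDen t x = -t ^ 2 + 2 * t * x + t - x := div_mul_cancel₀ _ hd
  rw [sub_mul, this]; unfold hDen; ring

lemma lt_h {t x : ℝ} (ht : 1 / 2 ≤ t) (ht1 : t < 1) (hx0 : 0 ≤ x) (hx : x < 1) : x < h t x := by
  have hd := hDen_pos ht hx0 hx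
  have := h_sub_self hd.ne'
  have h2 : 0 < (1 - t) * (x ^ 2 - x + t) :=
    mul_pos (by linarith) (by nlinarith [sq_nonneg (x - 1 / 2)])
  rw [← this] at h2
  linarith [pos_of_mul_pos_left h2 hd.le]

lemma h_lt_h {t x y : ℝ} (ht : 1 / 2 ≤ t) (hx0 : 0 ≤ x) (hxy : x < y) (hy : y < 1) :
    h t x < h t y := by
  have hdx := hDen_pos ht hx0 (hxy.trans hy)
  have hdy := hDen_pos ht (hx0.trans hxy.le) hy
  unfold h
  rw [div_lt_div_iff₀ hdx hdy]
  -- The Möbius map has determinant `t³`, so the cross-multiplied difference is `t³ (y - x)`.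
  have : 0 < t ^ 3 * (y - x) := mul_pos (by positivity) (by linarith)
  unfold hDen
  nlinarith

lemma h_le_h {t x y : ℝ} (ht : 1 / 2 ≤ t) (hx0 : 0 ≤ x) (hxy : x ≤ y) (hy : y < 1) :
    h t x ≤ h t y := by
  rcases hxy.eq_or_lt with rfl | hlt
  · exact le_rfl
  · exact (h_lt_h ht hx0 hlt hy).le

lemma h_le_iff {t x y : ℝ} (hd : 0 < hDen t x) :
    h t x ≤ y ↔ (1 - t) * (x ^ 2 - x + t) ≤ (y - x) * hDen t x := by
  rw [← h_sub_self hd.ne', mul_le_mul_iff_left₀ hd]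
  constructor <;> intro H <;> linarith

/-! ### The orbit of `0` and its dependence on `t` -/

lemma aSeq_one (k : ℕ) : aSeq 1 k = 0 := by
  induction k with
  | zero => rfl
  | succ k ih => simp [aSeq, ih, h]

lemma aSeq_nonneg {t : ℝ} {n : ℕ} (ht : 1 / 2 ≤ t) (ht1 : t < 1) (H : ∀ k < n, aSeq t k ≤ t) :
    ∀ k ≤ n, 0 ≤ aSeq t k := by
  intro k
  induction k with
  | zero => intro _; exact le_rfl
  | succ k ih =>
    intro hk
    have h0 := ih (by omega)
    exact h0.trans (lt_h ht ht1 h0 ((H k (by omega)).trans_lt ht1)).le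

lemma aSeq_lt_succ {t : ℝ} {n : ℕ} (ht : 1 / 2 ≤ t) (ht1 : t < 1) (H : ∀ k < n, aSeq t k ≤ t)
    {k : ℕ} (hk : k < n) : aSeq t k < aSeq t (k + 1) :=
  lt_h ht ht1 (aSeq_nonneg ht ht1 H k hk.le) ((H k hk).trans_lt ht1)

lemma continuousAt_aSeq {t : ℝ} {n : ℕ} (ht : 1 / 2 ≤ t)
    (H : ∀ k < n, 0 ≤ aSeq t k ∧ aSeq t k < 1) :
    ∀ k ≤ n, ContinuousAt (fun s => aSeq s k) t := by
  intro k
  induction k with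
  | zero => intro _; exact continuousAt_const
  | succ k ih =>
    intro hk
    have hc := ih (by omega)
    obtain ⟨h0, h1⟩ := H k (by omega)
    have hd := (hDen_pos ht h0 h1).ne'
    simp only [aSeq, h, hDen] at hd ⊢
    exact ContinuousAt.div (by fun_prop) (by fun_prop) hd

/-- If the orbit of `0` under `h t` stays below `t`, then `t` can be decreased. -/
lemma exists_lt_forall_aSeq_lt {t : ℝ} {n : ℕ} (ht : 1 / 2 < t)
    (H : ∀ k < n, 0 ≤ aSeq t k ∧ aSeq t k < t) (ht1 : t ≤ 1) :
    ∃ s, 1 / 2 < s ∧ s < t ∧ ∀ k < n, aSeq s k < s := by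
  have hc := continuousAt_aSeq ht.le fun k hk => ⟨(H k hk).1, (H k hk).2.trans_le ht1⟩
  have h1 : ∀ᶠ s in nhds t, ∀ k ∈ Finset.range n, aSeq s k < s := by
    rw [Filter.eventually_all_finset]
    intro k hk
    rw [Finset.mem_range] at hk
    exact (hc k hk.le).eventually_lt continuousAt_id (H k hk).2
  have h2 : ∀ᶠ s in nhds t, 1 / 2 < s := lt_mem_nhds ht
  have h3 : ∀ᶠ s in nhdsWithin t (Set.Iio t), s < t := self_mem_nhdsWithin
  obtain ⟨s, ⟨hs1, hs2⟩, hs3⟩ :=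
    (((h1.and h2).filter_mono nhdsWithin_le_nhds).and h3).exists
  exact ⟨s, hs2, hs3, fun k hk => hs1 k (Finset.mem_range.2 hk)⟩

/-! ### Comparison of admissible sequences with the orbit -/

section Comparison

variable {t : ℝ} {n : ℕ} {b : ℕ → ℝ}

/-- The condition on the partial sums `b k` that bounds all compressions by `√t`. -/
structure Admissible (t : ℝ) (n : ℕ) (b : ℕ → ℝ) : Prop where
  zero : b 0 = 0
  last : b n = 1
  nonneg : ∀ k, 0 ≤ b k
  le_one : ∀ k, b k ≤ 1
  step : ∀ k < n, (1 - t) * (b k ^ 2 - b k + t) ≤ (b (k + 1) - b k) * hDen t (b k)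

/-- Since `b (k + 1) ≤ 1`, the step condition says `h t (b k) ≤ 1`. It is used in multiplied-out
form because the denominator vanishes at `t = 1/2`, `x = 1`. -/
lemma Admissible.le (hb : Admissible t n b) (ht : 1 / 2 ≤ t) {k : ℕ} (hk : k < n) : b k ≤ t := by
  have h1 := hb.step k hk
  have h2 : (b (k + 1) - b k) * hDen t (b k) ≤ (1 - b k) * hDen t (b k) :=
    mul_le_mul_of_nonneg_right (by linarith [hb.le_one (k + 1)])
      (hDen_nonneg ht (hb.nonneg k) (hb.le_one k))
  have h3 : (1 - b k) * hDen t (b k) - (1 - t) * (b k ^ 2 - b k + t) = t * (t - b k) := by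
    unfold hDen; ring
  have h4 : 0 ≤ t * (t - b k) := by linarith
  linarith [nonneg_of_mul_nonneg_right h4 (by linarith)]

lemma Admissible.h_le (hb : Admissible t n b) (ht : 1 / 2 ≤ t) (ht1 : t < 1) {k : ℕ} (hk : k < n) :
    h t (b k) ≤ b (k + 1) :=
  (h_le_iff (hDen_pos ht (hb.nonneg k) ((hb.le ht hk).trans_lt ht1))).2 (hb.step k hk)

lemma Admissible.aSeq_le (hb : Admissible t n b) (ht : 1 / 2 ≤ t) (ht1 : t < 1) :
    ∀ k ≤ n, 0 ≤ aSeq t k ∧ aSeq t k ≤ b k := by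
  intro k
  induction k with
  | zero => intro _; exact ⟨le_rfl, hb.zero.ge⟩
  | succ k ih =>
    intro hk
    obtain ⟨h0, h1⟩ := ih (by omega)
    have h2 : b k < 1 := (hb.le ht hk).trans_lt ht1
    exact ⟨h0.trans (lt_h ht ht1 h0 (h1.trans_lt h2)).le,
      (h_le_h ht h0 h1 h2).trans (hb.h_le ht ht1 hk)⟩

/-- A strict gap at some `k < n` would propagate by strict monotonicity of `h t` up to index `n -
1`, where it would contradict `b (n - 1) ≤ t`. -/
lemma Admissible.eq_aSeq (hb : Admissible t n b) (ht : 1 / 2 ≤ t) (ht1 : t < 1) (hn : 0 < n)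
    (hlast : aSeq t (n - 1) = t) : ∀ k ≤ n, b k = aSeq t k := by
  have hlt : ∀ k < n, b k = aSeq t k := by
    intro k hk
    by_contra hne
    have h0 : aSeq t k < b k := lt_of_le_of_ne (hb.aSeq_le ht ht1 k hk.le).2 (Ne.symm hne)
    have key : ∀ m, k + m < n → aSeq t (k + m) < b (k + m) := by
      intro m
      induction m with
      | zero => intro _; exact h0
      | succ m ih =>
        intro hm
        have h1 := ih (by omega)
        exact (h_lt_h ht (hb.aSeq_le ht ht1 (k + m) (by omega)).1 h1
          ((hb.le ht (by omega)).trans_lt ht1)).trans_le (hb.h_le ht ht1 (by omega))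
    have h1 := key (n - 1 - k) (by omega)
    rw [show k + (n - 1 - k) = n - 1 by omega, hlast] at h1
    exact absurd (hb.le ht (k := n - 1) (by omega)) (not_le.2 h1)
  intro k hk
  rcases hk.eq_or_lt with rfl | hk
  · obtain ⟨m, rfl⟩ : ∃ m, k = m + 1 := ⟨k - 1, by omega⟩
    rw [Nat.add_sub_cancel] at hlast
    have hd := hDen_pos (x := t) ht (by linarith) ht1
    have h1 := one_sub_h hd.ne'
    rw [sub_self, mul_zero, mul_eq_zero, or_iff_left hd.ne'] at h1
    rw [hb.last, aSeq, hlast]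
    linarith
  · exact hlt k hk

end Comparison

end ProjNil

/-! ### Schur triangularization of nilpotents -/

open Module in
/-- A nilpotent operator on a finite-dimensional inner product space has a strictly upper
triangular matrix in some orthonormal basis of each invariant subspace. -/
lemma IsNilpotent.exists_orthonormal_strictUpper {E : Type*} [NormedAddCommGroup E]
    [InnerProductSpace ℂ E] [FiniteDimensional ℂ E] {f : E →ₗ[ℂ] E} (hf : IsNilpotent f) (m : ℕ) :
    ∀ S : Submodule ℂ E, S.map f ≤ S → finrank ℂ S = m →
      ∃ v : Fin m → E, (∀ i, v i ∈ S) ∧ Orthonormal ℂ v ∧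
        ∀ i j, j ≤ i → inner ℂ (v i) (f (v j)) = 0 := by
  induction m with
  | zero =>
    intro S _ _
    exact ⟨Fin.elim0, fun i => i.elim0, ⟨fun i => i.elim0, fun i => i.elim0⟩, fun i => i.elim0⟩
  | succ m ih =>
    intro S hS hm
    -- Nilpotency makes `f(S)` a proper subspace of `S`. A unit vector `u` of `S` orthogonal to
    -- `f(S)` serves as the last basis vector, and the induction continues on the invariant subspace
    -- `u^⊥ ∩ S`.
    have hne : S.map f ≠ S := by
      intro heq
      obtain ⟨p, hp⟩ := hf
      have : ∀ q, S.map (f ^ q) = S := by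
        intro q
        induction q with
        | zero => simp [Module.End.one_eq_id]
        | succ q ihq => rw [_root_.pow_succ, Module.End.mul_eq_comp, Submodule.map_comp, heq, ihq]
      have h0 := this p
      rw [hp, Submodule.map_zero] at h0
      rw [← h0, finrank_bot] at hm
      omega
    have hlt := Submodule.finrank_lt_finrank_of_lt (lt_of_le_of_ne hS hne)
    have hadd := Submodule.finrank_add_inf_finrank_orthogonal hS
    have hex : (S.map f)ᗮ ⊓ S ≠ ⊥ := by
      intro hb
      rw [hb, finrank_bot] at hadd
      omega
    obtain ⟨u₀, hu₀, hu₀ne⟩ := Submodule.exists_mem_ne_zero_of_ne_bot hex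
    obtain ⟨u, hu, hu1⟩ : ∃ u ∈ (S.map f)ᗮ ⊓ S, ‖u‖ = 1 :=
      ⟨((‖u₀‖ : ℂ)⁻¹) • u₀, Submodule.smul_mem _ _ hu₀, norm_smul_inv_norm hu₀ne⟩
    have huS : ℂ ∙ u ≤ S := (Submodule.span_singleton_le_iff_mem _ _).2 hu.2
    have hune : u ≠ 0 := by rintro rfl; simp at hu1
    have hadd' := Submodule.finrank_add_inf_finrank_orthogonal huS
    rw [finrank_span_singleton hune] at hadd'
    have hfS : S.map f ≤ (ℂ ∙ u)ᗮ ⊓ S := by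
      refine le_inf (fun y hy => ?_) hS
      rw [Submodule.mem_orthogonal_singleton_iff_inner_right]
      exact (Submodule.mem_orthogonal' _ _).1 hu.1 y hy
    obtain ⟨v, hv, hvo, hvf⟩ := ih ((ℂ ∙ u)ᗮ ⊓ S)
      ((Submodule.map_mono inf_le_right).trans hfS) (by omega)
    have huv : ∀ i, inner ℂ u (v i) = 0 := fun i =>
      Submodule.mem_orthogonal_singleton_iff_inner_right.1 (hv i).1
    have huf : ∀ w ∈ S, inner ℂ u (f w) = 0 := fun w hw =>
      (Submodule.mem_orthogonal' _ _).1 hu.1 _ (Submodule.mem_map_of_mem hw)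
    refine ⟨Fin.snoc v u, ?_, ?_, ?_⟩
    · intro i
      refine Fin.lastCases ?_ (fun i => ?_) i
      · simpa using hu.2
      · simpa using (hv i).2
    · rw [orthonormal_iff_ite] at hvo ⊢
      intro i j
      refine Fin.lastCases ?_ (fun i => ?_) i <;> refine Fin.lastCases ?_ (fun j => ?_) j
      · simp [inner_self_eq_norm_sq_to_K, hu1]
      · simp [huv, (Fin.castSucc_lt_last j).ne']
      · simp [inner_eq_zero_symm.1 (huv i), (Fin.castSucc_lt_last i).ne]
      · simp [hvo]
    · intro i j
      refine Fin.lastCases ?_ (fun i => ?_) i <;> refine Fin.lastCases ?_ (fun j => ?_) j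
      · intro _; simpa using huf u hu.2
      · intro _; simpa using huf (v j) (hv j).2
      · intro hle; exact absurd hle (not_le.2 (Fin.castSucc_lt_last i))
      · intro hle; simpa using hvf i j (by simpa using hle)

namespace ProjNil

open Matrix

/-- Schur triangularization of a nilpotent matrix. -/
lemma exists_unitary_conj_mem_strictUpper {n : ℕ} {N : Mat n} (hN : IsNilpotent N) :
    ∃ W ∈ unitaryGroup (Fin n) ℂ, Wᴴ * N * W ∈ strictUpper n := by
  have hf : IsNilpotent (Matrix.toEuclideanCLM (n := Fin n) (𝕜 := ℂ) N :
      EuclideanSpace ℂ (Fin n) →ₗ[ℂ] EuclideanSpace ℂ (Fin n)) := by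
    obtain ⟨p, hp⟩ := hN
    refine ⟨p, ?_⟩
    rw [← ContinuousLinearMap.toLinearMap_pow, ← map_pow, hp, map_zero]
    rfl
  obtain ⟨v, -, hv, hvf⟩ := hf.exists_orthonormal_strictUpper n ⊤ le_top (by simp)
  refine ⟨Matrix.of fun i j => v j i, ?_, ?_⟩
  · rw [mem_unitaryGroup_iff']
    ext i j
    have := (orthonormal_iff_ite.1 hv) i j
    rw [PiLp.inner_apply] at this
    simp only [RCLike.inner_apply] at this
    rw [star_eq_conjTranspose, mul_apply, one_apply, ← this]
    exact Finset.sum_congr rfl fun l _ => by simp [mul_comm]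
  · intro i j hij
    have := hvf i j hij
    rw [PiLp.inner_apply] at this
    rw [Matrix.mul_assoc, mul_apply, ← this]
    refine Finset.sum_congr rfl fun l _ => ?_
    simp [mul_comm, mul_apply, mulVec, dotProduct]

/-! ### Strictly upper triangular matrices and nearest points -/

lemma isNilpotent_of_mem_strictUpper {n : ℕ} {T : Mat n} (hT : T ∈ strictUpper n) :
    IsNilpotent T := by
  have h1 : T.charpoly = Polynomial.X ^ n := by
    rw [charpoly_of_isUpperTriangular T (fun i j hij => hT i j hij.le)]
    simp [hT _ _ le_rfl]
  have h2 := aeval_self_charpoly T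
  rw [h1] at h2
  exact ⟨n, by simpa using h2⟩

lemma isClosed_strictUpper (n : ℕ) : IsClosed (strictUpper n) := by
  have : strictUpper n = ⋂ i, ⋂ j, ⋂ (_ : j ≤ i), {T : Mat n | T i j = 0} := by
    ext T; simp [strictUpper]
  rw [this]
  refine isClosed_iInter fun i => isClosed_iInter fun j => isClosed_iInter fun _ => ?_
  have hc : Continuous fun T : Mat n => T i j :=
    (LinearMap.continuous_of_finiteDimensional (Matrix.entryLinearMap ℂ ℂ i j))
  exact isClosed_singleton.preimage hc

lemma strictUpper_nonempty (n : ℕ) : (strictUpper n).Nonempty := ⟨0, fun _ _ _ => rfl⟩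

lemma exists_isNearest (n : ℕ) (A : Mat n) : ∃ T, IsNearest n A T := by
  have : ProperSpace (Mat n) := FiniteDimensional.proper ℂ _
  obtain ⟨T, hT, h⟩ :=
    (isClosed_strictUpper n).exists_infDist_eq_dist (strictUpper_nonempty n) A
  exact ⟨T, hT, by rw [distT, h, dist_eq_norm]⟩

lemma distT_le {n : ℕ} {A T : Mat n} (hT : T ∈ strictUpper n) : distT n A ≤ ‖A - T‖ := by
  rw [← dist_eq_norm]; exact Metric.infDist_le_dist_of_mem hT

/-! ### Projections of rank `n - 1` as complements of unit vectors -/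

/-- The projection onto the orthogonal complement of the unit vector `e`. -/
def compl {n : ℕ} (e : Fin n → ℂ) : Mat n := 1 - vecMulVec e (star e)

lemma compl_apply {n : ℕ} (e : Fin n → ℂ) (i j : Fin n) :
    compl e i j = (if i = j then 1 else 0) - e i * star (e j) := by
  simp [compl, one_apply, vecMulVec_apply]

lemma rank_eq_trace_of_idempotent {n : ℕ} {Q : Mat n} (hQ : IsIdempotentElem Q) :
    (Q.rank : ℂ) = Q.trace := by
  have h1 : IsIdempotentElem (toLin' Q) := by
    rw [IsIdempotentElem, Module.End.mul_eq_comp, ← toLin'_mul, hQ.eq]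
  rw [← trace_toLin'_eq, (LinearMap.IsIdempotentElem.isProj_range _ h1).trace]
  rfl

lemma star_dotProduct_self {n : ℕ} (e : Fin n → ℂ) :
    star e ⬝ᵥ e = ((∑ i, ‖e i‖ ^ 2 : ℝ) : ℂ) := by
  simp [dotProduct, Complex.conj_mul']

lemma isProjOfRank_compl {n : ℕ} {e : Fin n → ℂ} (he : ∑ i, ‖e i‖ ^ 2 = 1) :
    IsProjOfRank n (n - 1) (compl e) := by
  have he' : star e ⬝ᵥ e = 1 := by rw [star_dotProduct_self, he]; simp
  have hP : IsStarProjection (vecMulVec e (star e)) := by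
    refine ⟨?_, ?_⟩
    · rw [IsIdempotentElem, vecMulVec_mul_vecMulVec, he', one_smul]
    · rw [isSelfAdjoint_iff, star_eq_conjTranspose, conjTranspose_vecMulVec, star_star]
  refine ⟨hP.one_sub, ?_⟩
  have hn : 1 ≤ n := by
    rcases Nat.eq_zero_or_pos n with rfl | h
    · simp at he
    · exact h
  have := rank_eq_trace_of_idempotent hP.one_sub.isIdempotentElem
  rw [trace_sub, trace_one, trace_vecMulVec, dotProduct_comm, he', Fintype.card_fin] at this
  have h2 : ((compl e).rank : ℂ) = ((n - 1 : ℕ) : ℂ) := by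
    rw [Nat.cast_sub hn, Nat.cast_one]; exact this
  exact_mod_cast h2

lemma IsProjOfRank.exists_eq_compl {n : ℕ} (hn : 1 ≤ n) {Q : Mat n}
    (hQ : IsProjOfRank n (n - 1) Q) : ∃ e : Fin n → ℂ, ∑ i, ‖e i‖ ^ 2 = 1 ∧ Q = compl e := by
  have hP := hQ.1.one_sub
  have hr : (1 - Q).rank = 1 := by
    have h1 := rank_eq_trace_of_idempotent hP.isIdempotentElem
    have h2 := rank_eq_trace_of_idempotent hQ.1.isIdempotentElem
    rw [trace_sub, trace_one, ← h2, hQ.2, Fintype.card_fin, Nat.cast_sub hn] at h1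
    have : ((1 - Q).rank : ℂ) = (1 : ℕ) := by rw [h1]; push_cast; ring
    exact_mod_cast this
  rw [Matrix.rank, finrank_eq_one_iff'] at hr
  obtain ⟨⟨u, hu⟩, hu0, hspan⟩ := hr
  have hu0' : u ≠ 0 := fun h => hu0 (Subtype.ext h)
  obtain ⟨w, hw⟩ := hu
  have hPu : (1 - Q) *ᵥ u = u := by
    rw [← hw, mulVecLin_apply, mulVec_mulVec, hP.isIdempotentElem.eq]
  have hpos : 0 < ∑ i, ‖u i‖ ^ 2 := by
    obtain ⟨i, hi⟩ := Function.ne_iff.1 hu0'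
    refine Finset.sum_pos' (fun _ _ => by positivity) ⟨i, Finset.mem_univ _, ?_⟩
    have : 0 < ‖u i‖ := norm_pos_iff.2 hi
    positivity
  have hPH : (1 - Q)ᴴ = 1 - Q := hP.isSelfAdjoint
  set c := ∑ i, ‖u i‖ ^ 2 with hc
  -- The range of `1 - Q` is spanned by `u`; self-adjointness identifies the coefficient as that of
  -- orthogonal projection onto `u`.
  have hkey : ∀ v, (1 - Q) *ᵥ v = ((star u ⬝ᵥ v) / c : ℂ) • u := by
    intro v
    obtain ⟨a, ha⟩ := hspan ⟨(1 - Q) *ᵥ v, ⟨v, rfl⟩⟩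
    have ha' : a • u = (1 - Q) *ᵥ v := congrArg Subtype.val ha
    have h1 : star u ⬝ᵥ ((1 - Q) *ᵥ v) = star u ⬝ᵥ v := by
      rw [dotProduct_mulVec]
      congr 1
      conv_lhs => rw [← hPH, ← star_mulVec, hPu]
    rw [← ha', dotProduct_smul, star_dotProduct_self, ← hc, smul_eq_mul] at h1
    have hc0 : (c : ℂ) ≠ 0 := by exact_mod_cast hpos.ne'
    rw [← ha', ← h1, mul_div_cancel_right₀ _ hc0]
  have hs : (Real.sqrt c : ℂ) * Real.sqrt c = c := by
    exact_mod_cast Real.mul_self_sqrt hpos.le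
  refine ⟨fun i => (Real.sqrt c : ℂ)⁻¹ * u i, ?_, ?_⟩
  · have : ∀ i, ‖(Real.sqrt c : ℂ)⁻¹ * u i‖ ^ 2 = c⁻¹ * ‖u i‖ ^ 2 := by
      intro i
      rw [norm_mul, mul_pow, norm_inv, Complex.norm_real, Real.norm_eq_abs,
        abs_of_nonneg (Real.sqrt_nonneg _), inv_pow, Real.sq_sqrt hpos.le]
    simp only [this, ← Finset.mul_sum]
    exact inv_mul_cancel₀ hpos.ne'
  · have hmat : 1 - Q = vecMulVec (fun i => (Real.sqrt c : ℂ)⁻¹ * u i)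
        (star fun i => (Real.sqrt c : ℂ)⁻¹ * u i) := by
      ext i j
      have := congrFun (hkey (Pi.single j 1)) i
      rw [mulVec_single_one] at this
      simp only [col_apply, Pi.smul_apply, dotProduct_single, smul_eq_mul, mul_one,
        Pi.star_apply] at this
      rw [this, ← hs, vecMulVec_apply]
      simp [div_eq_mul_inv]
      ring
    rw [compl, ← hmat, sub_sub_cancel]

/-! ### Unitary conjugation and norm estimates -/

lemma norm_unitary_conj {n : ℕ} {W : Mat n} (hW : W ∈ unitaryGroup (Fin n) ℂ) (A : Mat n) :
    ‖Wᴴ * A * W‖ = ‖A‖ := by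
  rw [CStarRing.norm_mul_mem_unitary _ hW]
  exact CStarRing.norm_mem_unitary_mul _ (Unitary.star_mem hW)

lemma conjTranspose_mem_unitaryGroup {n : ℕ} {W : Mat n} (hW : W ∈ unitaryGroup (Fin n) ℂ) :
    Wᴴ ∈ unitaryGroup (Fin n) ℂ := Unitary.star_mem hW

lemma IsProjOfRank.unitary_conj {n r : ℕ} {Q W : Mat n} (hQ : IsProjOfRank n r Q)
    (hW : W ∈ unitaryGroup (Fin n) ℂ) : IsProjOfRank n r (Wᴴ * Q * W) := by
  have h1 : W * Wᴴ = 1 := mem_unitaryGroup_iff.1 hW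
  have h2 : Wᴴ * W = 1 := mem_unitaryGroup_iff'.1 hW
  have hd : IsUnit W.det := (isUnit_iff_isUnit_det _).1 (IsUnit.of_mul_eq_one _ h1)
  have hd' : IsUnit Wᴴ.det := (isUnit_iff_isUnit_det _).1 (IsUnit.of_mul_eq_one _ h2)
  refine ⟨⟨?_, ?_⟩, ?_⟩
  · have := hQ.1.isIdempotentElem.eq
    calc Wᴴ * Q * W * (Wᴴ * Q * W) = Wᴴ * Q * (W * Wᴴ) * Q * W := by simp only [mul_assoc]
      _ = Wᴴ * Q * W := by rw [h1, mul_one, mul_assoc Wᴴ, this]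
  · have hs : Qᴴ = Q := hQ.1.isSelfAdjoint
    rw [isSelfAdjoint_iff, star_eq_conjTranspose]
    simp only [conjTranspose_mul, conjTranspose_conjTranspose, hs, mul_assoc]
  · rw [rank_mul_eq_left_of_isUnit_det _ _ hd, rank_mul_eq_right_of_isUnit_det _ _ hd', hQ.2]

lemma sum_norm_mulVec_sq_le {n : ℕ} {A : Mat n} {t : ℝ} (hA : ‖A‖ ^ 2 ≤ t) (v : Fin n → ℂ) :
    ∑ i, ‖(A *ᵥ v) i‖ ^ 2 ≤ t * ∑ i, ‖v i‖ ^ 2 := by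
  have h := l2_opNorm_mulVec A (WithLp.toLp 2 v)
  have h2 := pow_le_pow_left₀ (norm_nonneg _) h 2
  rw [mul_pow, EuclideanSpace.norm_sq_eq, EuclideanSpace.norm_sq_eq] at h2
  refine h2.trans (mul_le_mul_of_nonneg_right hA (Finset.sum_nonneg fun _ _ => by positivity))

lemma norm_sq_le_of_conjTranspose_mul_self {n : ℕ} {A : Mat n} {c : Fin n → ℝ} {t : ℝ}
    (h : Aᴴ * A = diagonal fun i => (c i : ℂ)) (hc : ∀ i, c i ≤ t) (ht : 0 ≤ t) :
    ‖A‖ ^ 2 ≤ t := by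
  rw [sq, ← l2_opNorm_conjTranspose_mul_self, h, l2_opNorm_diagonal, pi_norm_le_iff_of_nonneg ht]
  intro i
  have h1 : star (A.col i) ⬝ᵥ A.col i = c i := by
    have := congrFun (congrFun h i) i
    rw [diagonal_apply_eq] at this
    exact this
  have h2 : c i = ∑ l, ‖A.col i l‖ ^ 2 := by
    rw [star_dotProduct_self] at h1
    exact_mod_cast h1.symm
  rw [Complex.norm_real, Real.norm_eq_abs, abs_of_nonneg]
  · exact hc i
  · rw [h2]; exact Finset.sum_nonneg fun _ _ => by positivity

end ProjNil

namespace ProjNil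

open Matrix

variable {n : ℕ}

/-! ### Partial sums and truncations of a vector -/

/-- The squared norm of the first `k` entries of `e`. -/
noncomputable def headSum (e : Fin n → ℂ) (k : ℕ) : ℝ := ∑ i : Fin n, if (i : ℕ) < k then ‖e i‖ ^ 2 else 0

/-- The vector `e` with the entries from the `k`-th on replaced by `0`. -/
def head (e : Fin n → ℂ) (k : ℕ) : Fin n → ℂ := fun i => if (i : ℕ) < k then e i else 0

/-- The vector `e` with the entries before the `k`-th replaced by `0`. -/
def tail (e : Fin n → ℂ) (k : ℕ) : Fin n → ℂ := fun i => if (i : ℕ) < k then 0 else e i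

lemma headSum_zero (e : Fin n → ℂ) : headSum e 0 = 0 := by simp [headSum]

lemma headSum_last (e : Fin n → ℂ) : headSum e n = ∑ i, ‖e i‖ ^ 2 := by simp [headSum]

lemma headSum_succ (e : Fin n → ℂ) (k : Fin n) :
    headSum e (k + 1) = headSum e k + ‖e k‖ ^ 2 := by
  have : ‖e k‖ ^ 2 = ∑ i : Fin n, if i = k then ‖e i‖ ^ 2 else 0 := by simp
  rw [headSum, headSum, this, ← Finset.sum_add_distrib]
  refine Finset.sum_congr rfl fun i _ => ?_
  rcases lt_trichotomy i k with h | rfl | h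
  · simp [h.ne, Nat.lt_succ_of_lt (Fin.lt_def.1 h), Fin.lt_def.1 h]
  · simp
  · have := Fin.lt_def.1 h
    rw [if_neg (by omega), if_neg (by omega), if_neg h.ne', add_zero]

lemma headSum_nonneg (e : Fin n → ℂ) (k : ℕ) : 0 ≤ headSum e k :=
  Finset.sum_nonneg fun i _ => by split_ifs <;> positivity

lemma headSum_le (e : Fin n → ℂ) (k : ℕ) : headSum e k ≤ ∑ i, ‖e i‖ ^ 2 :=
  Finset.sum_le_sum fun i _ => by split_ifs <;> [exact le_rfl; positivity]

lemma sum_tail (e : Fin n → ℂ) (k : ℕ) :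
    ∑ i : Fin n, (if (i : ℕ) < k then 0 else ‖e i‖ ^ 2) = ∑ i, ‖e i‖ ^ 2 - headSum e k := by
  rw [headSum, ← Finset.sum_sub_distrib]
  exact Finset.sum_congr rfl fun i _ => by split_ifs <;> simp

/-- `A` differs from `compl e` by a strictly upper triangular matrix. -/
def AgreesBelow (e : Fin n → ℂ) (A : Mat n) : Prop := ∀ i j, j ≤ i → A i j = compl e i j

lemma agreesBelow_sub {e : Fin n → ℂ} {T : Mat n} (hT : T ∈ strictUpper n) :
    AgreesBelow e (compl e - T) := fun i j hij => by simp [hT i j hij]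

lemma AgreesBelow.sub_mem {e : Fin n → ℂ} {A : Mat n} (hA : AgreesBelow e A) :
    compl e - A ∈ strictUpper n := fun i j hij => by simp [hA i j hij]

/-- Rows from the `k`-th on meet columns before the `k`-th strictly below the diagonal, where `A`
has the entries `-e_i conj(e_j)`. -/
lemma AgreesBelow.mulVec_head_apply {e : Fin n → ℂ} {A : Mat n} (hA : AgreesBelow e A)
    (v : Fin n → ℂ) {k : ℕ} {i : Fin n} (hi : k ≤ i) :
    (A *ᵥ head v k) i = -(e i * (star e ⬝ᵥ head v k)) := by
  rw [mulVec, dotProduct, dotProduct, Finset.mul_sum, ← Finset.sum_neg_distrib]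
  refine Finset.sum_congr rfl fun j _ => ?_
  unfold head
  split_ifs with hj
  · have hji : j < i := Fin.lt_def.2 (by omega)
    rw [hA i j hji.le, compl_apply, if_neg hji.ne', Pi.star_apply]
    ring
  · simp

lemma star_dotProduct_head (e : Fin n → ℂ) (k : ℕ) : star e ⬝ᵥ head e k = headSum e k := by
  rw [headSum, Complex.ofReal_sum, dotProduct]
  refine Finset.sum_congr rfl fun i _ => ?_
  unfold head
  split_ifs
  · rw [Pi.star_apply, RCLike.star_def, Complex.conj_mul', Complex.ofReal_pow]
  · simp

lemma AgreesBelow.mulVec_head_self {e : Fin n → ℂ} {A : Mat n} (hA : AgreesBelow e A)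
    {k : ℕ} {i : Fin n} (hi : k ≤ i) : (A *ᵥ head e k) i = -(headSum e k * e i) := by
  rw [hA.mulVec_head_apply e hi, star_dotProduct_head, mul_comm]

/-! ### The test vectors -/

/-- The coefficient of the head of `e` in the test vector. -/
noncomputable def coef (t x : ℝ) : ℝ := x / (x ^ 2 - x + t)

/-- The amount by which the squared norm of a column of the optimal approximant stays below
`t`, as a function of `x = headSum e k` and `d = ‖e k‖ ^ 2`. -/
noncomputable def slack (t x d : ℝ) : ℝ := t - 1 + d * (1 + x) - d * coef t x * x ^ 2

lemma coef_den_pos {t : ℝ} (ht : 1 / 4 < t) (x : ℝ) : 0 < x ^ 2 - x + t := by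
  nlinarith [sq_nonneg (x - 1 / 2)]

lemma coef_mul {t : ℝ} (ht : 1 / 4 < t) (x : ℝ) : coef t x * (x ^ 2 - x + t) = x :=
  div_mul_cancel₀ _ (coef_den_pos ht x).ne'

/-- This links the norm estimate to the recursion: up to a positive factor, the slack is the defect
in the step condition of `Admissible` with `d = b (k + 1) - b k`. -/
lemma slack_mul {t : ℝ} (ht : 1 / 4 < t) (x d : ℝ) :
    slack t x d * (x ^ 2 - x + t) = d * hDen t x - (1 - t) * (x ^ 2 - x + t) := by
  have := coef_mul ht x
  unfold slack hDen
  linear_combination (-d * x ^ 2) * this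

lemma slack_nonneg_iff {t : ℝ} (ht : 1 / 4 < t) (x d : ℝ) :
    0 ≤ slack t x d ↔ (1 - t) * (x ^ 2 - x + t) ≤ d * hDen t x := by
  rw [← mul_nonneg_iff_of_pos_right (coef_den_pos ht x), slack_mul ht, sub_nonneg]

lemma slack_eq_zero_iff {t : ℝ} (ht : 1 / 4 < t) (x d : ℝ) :
    slack t x d = 0 ↔ d * hDen t x = (1 - t) * (x ^ 2 - x + t) := by
  rw [← mul_eq_zero_iff_right (coef_den_pos ht x).ne', slack_mul ht, sub_eq_zero]

/-- The maximizing vector of the compression to the last rows and first `k + 1` columns. -/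
noncomputable def testVec (e : Fin n → ℂ) (t : ℝ) (k : Fin n) : Fin n → ℂ :=
  Pi.single k 1 - (star (e k) * coef t (headSum e k)) • head e k

lemma sum_norm_testVec_sq (e : Fin n → ℂ) (t : ℝ) (k : Fin n) :
    ∑ i, ‖testVec e t k i‖ ^ 2 = 1 + ‖e k‖ ^ 2 * coef t (headSum e k) ^ 2 * headSum e k := by
  have h1 : (1 : ℝ) = ∑ i : Fin n, if i = k then (1 : ℝ) else 0 := by simp
  conv_rhs => rw [h1]
  conv_rhs => rw [headSum]
  rw [Finset.mul_sum, ← Finset.sum_add_distrib]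
  refine Finset.sum_congr rfl fun i _ => ?_
  simp only [testVec, head, Pi.sub_apply, Pi.smul_apply, smul_eq_mul, Pi.single_apply]
  rcases lt_trichotomy i k with h | rfl | h
  · rw [if_neg h.ne, if_pos (Fin.lt_def.1 h), if_neg h.ne, if_pos (Fin.lt_def.1 h), zero_sub,
      norm_neg, norm_mul, norm_mul, norm_star, Complex.norm_real, mul_pow, mul_pow,
      Real.norm_eq_abs, sq_abs, zero_add]
    rfl
  · simp
  · have := Fin.lt_def.1 h
    simp [h.ne', this.not_gt]

lemma AgreesBelow.norm_mulVec_testVec_sq {e : Fin n → ℂ} {A : Mat n} (hA : AgreesBelow e A)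
    (t : ℝ) {k i : Fin n} (hi : k ≤ i) :
    ‖(A *ᵥ testVec e t k) i‖ ^ 2 =
      (if i = k then 1 - 2 * ‖e k‖ ^ 2 * (1 - coef t (headSum e k) * headSum e k) else 0) +
      ‖e k‖ ^ 2 * (1 - coef t (headSum e k) * headSum e k) ^ 2 * ‖e i‖ ^ 2 := by
  set x := headSum e k
  set r : ℝ := 1 - coef t x * x with hr
  have h1 : (A *ᵥ testVec e t k) i = (if i = k then 1 else 0) - r * (star (e k) * e i) := by
    rw [testVec, mulVec_sub, mulVec_smul, mulVec_single_one, Pi.sub_apply, Pi.smul_apply,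
      hA.mulVec_head_self (Fin.le_def.1 hi), col_apply, hA i k hi, compl_apply, hr, smul_eq_mul]
    push_cast
    ring
  rw [h1]
  split_ifs with hik
  · subst hik
    rw [RCLike.star_def, Complex.conj_mul']
    have : (1 : ℂ) - r * (‖e i‖ : ℂ) ^ 2 = ((1 - r * ‖e i‖ ^ 2 : ℝ) : ℂ) := by push_cast; ring
    rw [this, Complex.norm_real, Real.norm_eq_abs, sq_abs]
    ring
  · rw [zero_sub, norm_neg, norm_mul, norm_mul, norm_star, Complex.norm_real, mul_pow, mul_pow,
      Real.norm_eq_abs, sq_abs]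
    ring

/-- In `‖A v‖² ≤ t ‖v‖²` for the test vector, rows from the `k`-th on contribute a known amount, and
what is left for the rows above is the slack. With a free coefficient `β` in place of `coef`, this
bound is quadratic in `β`, and `coef` is its minimizer. -/
lemma AgreesBelow.sum_top_le_slack {e : Fin n → ℂ} {A : Mat n} (hA : AgreesBelow e A)
    (he : ∑ i, ‖e i‖ ^ 2 = 1) {t : ℝ} (ht : 1 / 4 < t) (hAt : ‖A‖ ^ 2 ≤ t) (k : Fin n) :
    ∑ i, (if i < k then ‖(A *ᵥ testVec e t k) i‖ ^ 2 else 0) ≤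
      slack t (headSum e k) (‖e k‖ ^ 2) := by
  have h1 := sum_norm_mulVec_sq_le hAt (testVec e t k)
  rw [sum_norm_testVec_sq] at h1
  set x := headSum e k with hx
  set r : ℝ := 1 - coef t x * x with hr
  have h2 : ∑ i, ‖(A *ᵥ testVec e t k) i‖ ^ 2 =
      ∑ i, (if i < k then ‖(A *ᵥ testVec e t k) i‖ ^ 2 else 0) +
        ((1 - 2 * ‖e k‖ ^ 2 * r) + ‖e k‖ ^ 2 * r ^ 2 * (1 - x)) := by
    have h3 : 1 - 2 * ‖e k‖ ^ 2 * r =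
        ∑ i, if i = k then 1 - 2 * ‖e k‖ ^ 2 * r else 0 := by simp
    have h4 := sum_tail e k
    rw [he, ← hx] at h4
    rw [← h4, h3, Finset.mul_sum, ← Finset.sum_add_distrib,
      ← Finset.sum_add_distrib]
    refine Finset.sum_congr rfl fun i _ => ?_
    by_cases hik : i < k
    · simp [hik, hik.ne]
    · rw [hA.norm_mulVec_testVec_sq t (not_lt.1 hik), if_neg hik, if_neg (mt Fin.lt_def.2 hik),
        zero_add]
  rw [h2] at h1
  have h3 := coef_mul ht x
  refine (le_sub_iff_add_le.2 h1).trans (le_of_eq ?_)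
  unfold slack
  rw [hr]
  linear_combination (‖e k‖ ^ 2 * coef t x * x) * h3

/-! ### Construction of the approximant -/

/-- Given orthogonal columns before the `k`-th, there is an orthogonal `k`-th one. -/
lemma AgreesBelow.exists_next_col {e : Fin n → ℂ} {A : Mat n} (hA : AgreesBelow e A)
    (he : ∑ i, ‖e i‖ ^ 2 = 1) {t : ℝ} (ht : 1 / 4 < t) (k : Fin n)
    (horth : ∀ i j, i < k → j < k → star (A.col i) ⬝ᵥ A.col j = if i = j then (t : ℂ) else 0) :
    ∃ w : Fin n → ℂ, (∀ i, k ≤ i → w i = compl e i k) ∧ (∀ j < k, star (A.col j) ⬝ᵥ w = 0) ∧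
      star w ⬝ᵥ w = ((t - slack t (headSum e k) (‖e k‖ ^ 2) : ℝ) : ℂ) := by
  set x := headSum e k with hx
  set r := A *ᵥ head e k with hr
  set u := tail e k with hu
  have hri : ∀ i, k ≤ i → r i = -(x * e i) := fun i hi => hA.mulVec_head_self (Fin.le_def.1 hi)
  have huk : u k = e k := by simp [hu, tail]
  have hd : e k * star (e k) = (‖e k‖ : ℂ) ^ 2 := by rw [RCLike.star_def, Complex.mul_conj']
  have hr_sum : r = ∑ j, head e k j • A.col j := by
    rw [hr]; ext i; simp [mulVec, dotProduct, mul_comm]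
  have hcu : ∀ v : Fin n → ℂ, ∀ c : ℂ, (∀ i, k ≤ i → v i = c * e i) →
      star v ⬝ᵥ u = star c * (1 - x) := by
    intro v c hv
    have : (1 - x : ℂ) = ((∑ i : Fin n, (if (i : ℕ) < k then 0 else ‖e i‖ ^ 2) : ℝ) : ℂ) := by
      rw [sum_tail, he]; push_cast; rfl
    rw [this, Complex.ofReal_sum, Finset.mul_sum, dotProduct]
    refine Finset.sum_congr rfl fun i _ => ?_
    simp only [hu, tail]
    split_ifs with h
    · simp
    · rw [Pi.star_apply, hv i (Fin.le_def.2 (by omega)), star_mul', mul_assoc, RCLike.star_def,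
        Complex.conj_mul', Complex.ofReal_pow]
  have hcolr : ∀ j < k, star (A.col j) ⬝ᵥ r = t * e j := by
    intro j hj
    rw [hr_sum, dotProduct_sum]
    have : ∀ l, star (A.col j) ⬝ᵥ head e k l • A.col l =
        if l = j then t * e j else 0 := by
      intro l
      rw [dotProduct_smul, smul_eq_mul, head]
      by_cases hl : l < k
      · rw [if_pos (Fin.lt_def.1 hl), horth j l hj hl]
        by_cases hlj : l = j
        · subst hlj; simp [mul_comm]
        · simp [hlj, Ne.symm hlj]
      · have : l ≠ j := by rintro rfl; exact hl hj
        rw [if_neg (mt Fin.lt_def.2 hl), if_neg this, zero_mul]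
    simp [this]
  have hrr : star r ⬝ᵥ r = t * x := by
    conv_lhs => rw [hr_sum, star_sum, sum_dotProduct]
    rw [← hr_sum, hx, ← star_dotProduct_head, dotProduct, Finset.mul_sum]
    refine Finset.sum_congr rfl fun j _ => ?_
    rw [star_smul, smul_dotProduct, smul_eq_mul]
    by_cases hj : j < k
    · rw [hcolr j hj]
      simp only [head, if_pos (Fin.lt_def.1 hj), Pi.star_apply]
      ring
    · simp [head, mt Fin.lt_def.2 hj]
  have hru : star r ⬝ᵥ u = -(x * (1 - x)) := by
    rw [hcu r (-x) fun i hi => by rw [hri i hi]; ring]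
    simp
  have hur : star u ⬝ᵥ r = -(x * (1 - x)) := by
    rw [star_dotProduct, hru]
    simp
  have huu : star u ⬝ᵥ u = 1 - x := by
    rw [hcu u 1 fun i hi => by simp [hu, tail, not_lt.2 (Fin.le_def.1 hi)]]
    simp
  set β := coef t x with hβ
  have hβx : (β : ℂ) * (x ^ 2 - x + t) = x := by exact_mod_cast coef_mul ht x
  -- The column is sought as `δ_k + p u + q r`. Agreement with `compl e` in the rows from `k` on
  -- means `p - q x = -conj(e_k)`; orthogonality to the earlier columns means `q t - p (1 - x) =
  -- conj(e_k)`. The solution is `q = conj(e_k) β`, `p = q x - conj(e_k)`.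
  set p : ℂ := star (e k) * (β * x - 1) with hp
  set q : ℂ := star (e k) * β with hq
  refine ⟨Pi.single k 1 + (p • u + q • r), ?_, ?_, ?_⟩
  · intro i hi
    have hui : u i = e i := by simp [hu, tail, not_lt.2 (Fin.le_def.1 hi)]
    simp only [Pi.add_apply, Pi.smul_apply, smul_eq_mul, hui, hri i hi, compl_apply,
      Pi.single_apply, hp, hq]
    ring
  · intro j hj
    have hju : star (A.col j) ⬝ᵥ u = -(e j * (1 - x)) := by
      rw [hcu (A.col j) (-star (e j)) fun i hi => ?_]
      · simp
      · rw [col_apply, hA i j (hj.le.trans hi), compl_apply, if_neg (hj.trans_le hi).ne']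
        ring
    rw [dotProduct_add, dotProduct_add, dotProduct_smul, dotProduct_smul, hju, hcolr j hj,
      dotProduct_single_one, Pi.star_apply, col_apply, hA k j hj.le, compl_apply, if_neg hj.ne',
      zero_sub, star_neg, star_mul', star_star, smul_eq_mul, smul_eq_mul, hp, hq]
    linear_combination (star (e k) * e j) * hβx
  · have hsp : star p = e k * (β * x - 1) := by simp [hp]
    have hsq : star q = e k * β := by simp [hq]
    rw [star_add, star_add, star_smul, star_smul, add_dotProduct, dotProduct_add, dotProduct_add,
      add_dotProduct, dotProduct_add, dotProduct_add, dotProduct_add, dotProduct_add,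
      ← Pi.single_star, star_one]
    simp only [dotProduct_single_one, single_one_dotProduct, smul_dotProduct, dotProduct_smul,
      smul_eq_mul, Pi.smul_apply, Pi.star_apply, Pi.single_eq_same, huk,
      hri k le_rfl, huu, hrr, hru, hur, hsp, hsq, star_neg, star_mul']
    rw [hp, hq, slack, ← hβ]
    push_cast
    rw [← hd]
    simp only [RCLike.star_def, Complex.conj_ofReal]
    linear_combination (e k * starRingEnd ℂ (e k) * β * x) * hβx

/-- If all slacks but the last vanish, then the distance is attained by a matrix with orthogonal
columns. -/
lemma exists_orthogonal_cols {e : Fin n → ℂ} (he : ∑ i, ‖e i‖ ^ 2 = 1) {t : ℝ} (ht : 1 / 4 < t)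
    (hs : ∀ k : Fin n, (k : ℕ) + 1 < n → slack t (headSum e k) (‖e k‖ ^ 2) = 0) :
    ∃ A : Mat n, AgreesBelow e A ∧
      Aᴴ * A = diagonal fun k : Fin n => ((t - slack t (headSum e k) (‖e k‖ ^ 2) : ℝ) : ℂ) := by
  have key : ∀ m ≤ n, ∃ A : Mat n, AgreesBelow e A ∧ ∀ i j : Fin n, (i : ℕ) < m → (j : ℕ) < m →
      star (A.col i) ⬝ᵥ A.col j =
        if i = j then ((t - slack t (headSum e i) (‖e i‖ ^ 2) : ℝ) : ℂ) else 0 := by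
    intro m
    induction m with
    | zero => exact fun _ => ⟨compl e, fun i j _ => rfl, fun i j hi => absurd hi (by omega)⟩
    | succ m ih =>
      intro hm
      obtain ⟨A, hA, hcol⟩ := ih (by omega)
      set k : Fin n := ⟨m, hm⟩ with hk
      obtain ⟨w, hw1, hw2, hw3⟩ := hA.exists_next_col he ht k fun i j hi hj => by
        have hi' : (i : ℕ) < m := hi
        -- The earlier columns need squared norm exactly `t`. They are never the last column, which
        -- is why the last slack may be nonzero.
        rw [hcol i j hi hj, hs i (by omega), sub_zero]
      have hcolk : (A.updateCol k w).col k = w := by ext i; simp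
      have hcolne : ∀ j, j ≠ k → (A.updateCol k w).col j = A.col j := fun j hj => by
        ext i; simp [hj]
      have hlt : ∀ j : Fin n, (j : ℕ) < m + 1 → j ≠ k → j < k := fun j hj hne =>
        lt_of_le_of_ne (Fin.le_def.2 (Nat.lt_succ_iff.1 hj)) hne
      refine ⟨A.updateCol k w, ?_, ?_⟩
      · intro i j hij
        rw [updateCol_apply]
        split_ifs with h
        · subst h; exact hw1 i hij
        · exact hA i j hij
      · intro i j hi hj
        by_cases hik : i = k <;> by_cases hjk : j = k
        · rw [hik, hjk, hcolk, hw3, if_pos rfl]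
        · rw [hik, hcolk, hcolne j hjk, if_neg (Ne.symm hjk), star_dotProduct,
            hw2 j (hlt j hj hjk), star_zero]
        · rw [hjk, hcolk, hcolne i hik, if_neg hik, hw2 i (hlt i hi hik)]
        · rw [hcolne i hik, hcolne j hjk, hcol i j (hlt i hi hik) (hlt j hj hjk)]
  obtain ⟨A, hA, hcol⟩ := key n le_rfl
  refine ⟨A, hA, ?_⟩
  ext i j
  rw [diagonal_apply, ← hcol i j i.2 j.2]
  rfl

/-- The columns of the approximant are determined by the orthogonality relations. -/
lemma AgreesBelow.eq_zero_of_orthogonal {e : Fin n → ℂ} {A : Mat n} (hA : AgreesBelow e A)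
    (he : ∑ i, ‖e i‖ ^ 2 = 1) {t : ℝ} (ht : 1 / 4 < t) (hAA : Aᴴ * A = (t : ℂ) • 1)
    {k : ℕ} {y : Fin n → ℂ} (hy : ∀ i : Fin n, k ≤ i → y i = 0)
    (horth : ∀ j : Fin n, (j : ℕ) < k → A.col j ⬝ᵥ star y = 0) : y = 0 := by
  by_contra hne
  -- `M` has the first `k` columns of `A`, completed by standard basis vectors. A nonzero `y` would
  -- make it singular, and a kernel vector `z` gives `A (head z) = -tail z`, which vanishes in the
  -- first `k` rows.
  set M : Mat n := Matrix.of fun i j => if (j : ℕ) < k then A i j else if i = j then 1 else 0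
  have hyM : star y ᵥ* M = 0 := by
    ext j
    by_cases hj : (j : ℕ) < k
    · rw [Pi.zero_apply, ← horth j hj, dotProduct_comm]
      simp [vecMul, M, hj, col]
      rfl
    · simp [vecMul, dotProduct, M, hj, hy j (not_lt.1 hj)]
  obtain ⟨z, hz, hMz⟩ := exists_mulVec_eq_zero_iff.2
    (exists_vecMul_eq_zero_iff.1 ⟨star y, star_ne_zero.2 hne, hyM⟩)
  have hsplit : A *ᵥ head z k + tail z k = 0 := by
    rw [← hMz]
    ext i
    have : tail z k i = ∑ j, if i = j then tail z k j else 0 := by simp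
    rw [Pi.add_apply, this, mulVec, mulVec, dotProduct, dotProduct, ← Finset.sum_add_distrib]
    refine Finset.sum_congr rfl fun j _ => ?_
    by_cases hj : (j : ℕ) < k <;> simp [head, tail, M, hj]
  have hAz : ∀ i, (A *ᵥ head z k) i =
      if (i : ℕ) < k then 0 else -(e i * (star e ⬝ᵥ head z k)) := by
    intro i
    split_ifs with hi
    · have := congrFun hsplit i
      simpa [tail, hi] using this
    · exact hA.mulVec_head_apply z (not_lt.1 hi)
  have hnorm : ∑ i, ‖(A *ᵥ head z k) i‖ ^ 2 = t * ∑ i, ‖head z k i‖ ^ 2 := by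
    have : star (A *ᵥ head z k) ⬝ᵥ (A *ᵥ head z k) = t * (star (head z k) ⬝ᵥ head z k) := by
      rw [star_mulVec, ← dotProduct_mulVec, mulVec_mulVec, hAA, smul_mulVec, one_mulVec,
        dotProduct_smul, smul_eq_mul]
    rw [star_dotProduct_self, star_dotProduct_self] at this
    exact_mod_cast this
  have hsum : ∑ i, ‖(A *ᵥ head z k) i‖ ^ 2 =
      (1 - headSum e k) * ‖star e ⬝ᵥ head z k‖ ^ 2 := by
    rw [← he, ← sum_tail, Finset.sum_mul]
    refine Finset.sum_congr rfl fun i _ => ?_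
    rw [hAz i]
    split_ifs
    · simp
    · rw [norm_neg, norm_mul, mul_pow]
  have hcs : ‖star e ⬝ᵥ head z k‖ ^ 2 ≤ headSum e k * ∑ i, ‖head z k i‖ ^ 2 := by
    have h1 : ‖star e ⬝ᵥ head z k‖ ≤ ∑ i, ‖head e k i‖ * ‖head z k i‖ := by
      refine (norm_sum_le _ _).trans (Finset.sum_le_sum fun i _ => ?_)
      rw [norm_mul, Pi.star_apply, norm_star]
      unfold head
      split_ifs <;> simp
    have h2 : headSum e k = ∑ i, ‖head e k i‖ ^ 2 := by
      unfold headSum head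
      exact Finset.sum_congr rfl fun i _ => by split_ifs <;> simp
    rw [h2]
    exact (pow_le_pow_left₀ (norm_nonneg _) h1 2).trans (Finset.sum_mul_sq_le_sq_mul_sq _ _ _)
  have hx1 : 0 ≤ 1 - headSum e k := by linarith [headSum_le e k]
  -- With `x = headSum e k`, scaled unitarity and Cauchy–Schwarz give `t ‖head z‖² ≤ x (1 - x) ‖head
  -- z‖²`, while `x² - x + t > 0`.
  have hzero : ∑ i, ‖head z k i‖ ^ 2 = 0 := by
    have h1 := mul_le_mul_of_nonneg_left hcs hx1
    rw [← hsum, hnorm] at h1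
    have h2 : (headSum e k ^ 2 - headSum e k + t) * ∑ i, ‖head z k i‖ ^ 2 ≤ 0 := by
      linear_combination h1
    refine le_antisymm ?_ (Finset.sum_nonneg fun _ _ => by positivity)
    exact nonpos_of_mul_nonpos_right h2 (coef_den_pos ht _)
  have hhead : head z k = 0 := by
    ext i
    have := (Finset.sum_eq_zero_iff_of_nonneg fun _ _ => by positivity).1 hzero i
      (Finset.mem_univ i)
    simpa using this
  rw [hhead, mulVec_zero, zero_add] at hsplit
  refine hz (funext fun i => ?_)
  by_cases hi : (i : ℕ) < k
  · simpa [head, hi] using congrFun hhead i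
  · simpa [tail, hi] using congrFun hsplit i

end ProjNil

namespace ProjNil

open Matrix

variable {n : ℕ}

/-! ### Norm bounds in terms of the orbit -/

lemma headSum_mono (e : Fin n → ℂ) {k l : ℕ} (hkl : k ≤ l) : headSum e k ≤ headSum e l := by
  refine Finset.sum_le_sum fun i _ => ?_
  by_cases hi : (i : ℕ) < k
  · rw [if_pos hi, if_pos (hi.trans_le hkl)]
  · rw [if_neg hi]; split_ifs <;> positivity

lemma AgreesBelow.admissible {e : Fin n → ℂ} {A : Mat n} (hA : AgreesBelow e A)
    (he : ∑ i, ‖e i‖ ^ 2 = 1) {t : ℝ} (ht : 1 / 4 < t) (hAt : ‖A‖ ^ 2 ≤ t) :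
    Admissible t n (headSum e) where
  zero := headSum_zero e
  last := by rw [headSum_last, he]
  nonneg := headSum_nonneg e
  le_one k := he ▸ headSum_le e k
  step k hk := by
    have h1 := headSum_succ e ⟨k, hk⟩
    rw [h1, add_sub_cancel_left, ← slack_nonneg_iff ht]
    exact (Finset.sum_nonneg fun i _ => by split_ifs <;> positivity).trans
      (hA.sum_top_le_slack he ht hAt ⟨k, hk⟩)

lemma AgreesBelow.half_le_norm_sq {e : Fin n → ℂ} {A : Mat n} (hA : AgreesBelow e A)
    (he : ∑ i, ‖e i‖ ^ 2 = 1) (hn : 2 ≤ n) : 1 / 2 ≤ ‖A‖ ^ 2 := by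
  by_contra! hlt
  -- The test vectors need `t > 1/4`; `3/8` is any number between `1/4` and `1/2`. The step
  -- conditions at `0` and `n - 1` give `x_1 ≥ 1 - t` and `x_{n-1} ≤ t`, which contradicts `x_1 ≤
  -- x_{n-1}`.
  obtain ⟨t, ht, hAt, ht2⟩ : ∃ t : ℝ, 1 / 4 < t ∧ ‖A‖ ^ 2 ≤ t ∧ t < 1 / 2 :=
    ⟨max (‖A‖ ^ 2) (3 / 8), lt_max_of_lt_right (by norm_num), le_max_left _ _,
      max_lt hlt (by norm_num)⟩
  have hb := hA.admissible he ht hAt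
  have h0 := hb.step 0 (by omega)
  have h1 := hb.step (n - 1) (by omega)
  rw [Nat.sub_add_cancel (by omega), hb.last] at h1
  rw [hb.zero] at h0
  have hmono : headSum e (0 + 1) ≤ headSum e (n - 1) := headSum_mono e (by omega)
  unfold hDen at h0 h1
  have h2 : 0 ≤ t * (headSum e (0 + 1) - (1 - t)) := by linear_combination h0
  have h3 : 0 ≤ t * (t - headSum e (n - 1)) := by linear_combination h1
  have h4 := nonneg_of_mul_nonneg_right h2 (by linarith)
  have h5 := nonneg_of_mul_nonneg_right h3 (by linarith)
  linarith

/-- If the orbit of `0` under `h s` stays below `s`, then `√s` is an upper bound for the minimal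
distance. -/
lemma exists_norm_sq_le_of_aSeq_lt (hn : 0 < n) {s : ℝ} (hs : 1 / 2 ≤ s) (hs1 : s < 1)
    (H : ∀ k < n, aSeq s k < s) :
    ∃ e : Fin n → ℂ, ∑ i, ‖e i‖ ^ 2 = 1 ∧ ∃ A : Mat n, AgreesBelow e A ∧ ‖A‖ ^ 2 ≤ s := by
  have H' : ∀ k < n, aSeq s k ≤ s := fun k hk => (H k hk).le
  -- The partial sums follow the orbit up to `n - 1` and then jump to `1`; only the last slack can
  -- be positive.
  set b : ℕ → ℝ := fun k => if k < n then aSeq s k else 1 with hb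
  have hbk : ∀ k, k < n → b k = aSeq s k := fun k hk => if_pos hk
  have hbmono : ∀ k < n, 0 ≤ b (k + 1) - b k := by
    intro k hk
    rw [hbk k hk]
    simp only [hb]
    split_ifs with h1
    · linarith [aSeq_lt_succ hs hs1 H' hk]
    · linarith [H k hk]
  set e : Fin n → ℂ := fun i => (Real.sqrt (b (i + 1) - b i) : ℂ) with he
  have hei : ∀ i : Fin n, ‖e i‖ ^ 2 = b (i + 1) - b i := fun i => by
    rw [he, Complex.norm_real, Real.norm_eq_abs, sq_abs, Real.sq_sqrt (hbmono i i.2)]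
  have hsum : ∀ k ≤ n, headSum e k = b k := by
    intro k
    induction k with
    | zero => intro _; rw [headSum_zero, hbk 0 hn]; rfl
    | succ k ih =>
      intro hk
      have h1 := headSum_succ e ⟨k, hk⟩
      rw [h1, ih (by omega), hei]
      simp
  have he1 : ∑ i, ‖e i‖ ^ 2 = 1 := by
    rw [← headSum_last, hsum n le_rfl]; simp [hb]
  have hs4 : 1 / 4 < s := by linarith
  have hden : ∀ k < n, 0 < hDen s (aSeq s k) := fun k hk =>
    hDen_pos hs (aSeq_nonneg hs hs1 H' k hk.le) ((H k hk).trans hs1)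
  have hslack : ∀ k : Fin n, (k : ℕ) + 1 < n → slack s (headSum e k) (‖e k‖ ^ 2) = 0 := by
    intro k hk
    rw [slack_eq_zero_iff hs4, hsum k k.2.le, hei, hbk k k.2, hbk _ hk]
    exact h_sub_self (hden k k.2).ne'
  obtain ⟨A, hA, hAA⟩ := exists_orthogonal_cols he1 hs4 hslack
  refine ⟨e, he1, A, hA, norm_sq_le_of_conjTranspose_mul_self hAA (fun k => ?_) (by linarith)⟩
  by_cases hk : (k : ℕ) + 1 < n
  · rw [hslack k hk, sub_zero]
  · have hb1 : b (k + 1) = 1 := if_neg hk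
    rw [sub_le_self_iff, slack_nonneg_iff hs4, hsum k k.2.le, hei, hb1, hbk k k.2]
    have : 0 ≤ s * (s - aSeq s k) := mul_nonneg (by linarith) (by linarith [H k k.2])
    unfold hDen
    linear_combination this

/-! ### The minimal distance is attained -/

lemma continuous_compl : Continuous fun e : Fin n → ℂ => compl e := by
  unfold compl
  exact continuous_const.sub (Continuous.matrix_vecMulVec continuous_id continuous_star)

lemma exists_minimal_pair (hn : 0 < n) :
    ∃ e : Fin n → ℂ, ∑ i, ‖e i‖ ^ 2 = 1 ∧
      ∀ e' : Fin n → ℂ, ∑ i, ‖e' i‖ ^ 2 = 1 → distT n (compl e) ≤ distT n (compl e') := by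
  have hclosed : IsClosed {e : Fin n → ℂ | ∑ i, ‖e i‖ ^ 2 = 1} :=
    isClosed_eq (by fun_prop) continuous_const
  have hbdd : Bornology.IsBounded {e : Fin n → ℂ | ∑ i, ‖e i‖ ^ 2 = 1} := by
    refine (Metric.isBounded_closedBall (x := (0 : Fin n → ℂ)) (r := 1)).subset fun e he => ?_
    rw [mem_closedBall_zero_iff, pi_norm_le_iff_of_nonneg zero_le_one]
    intro i
    have h1 : ‖e i‖ ^ 2 ≤ ∑ i, ‖e i‖ ^ 2 :=
      Finset.single_le_sum (f := fun i => ‖e i‖ ^ 2) (fun _ _ => by positivity) (Finset.mem_univ i)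
    rw [show ∑ i, ‖e i‖ ^ 2 = 1 from he] at h1
    exact (sq_le_one_iff₀ (norm_nonneg _)).1 h1
  have hne : {e : Fin n → ℂ | ∑ i, ‖e i‖ ^ 2 = 1}.Nonempty := by
    refine ⟨Pi.single ⟨0, hn⟩ 1, ?_⟩
    change ∑ i, ‖(Pi.single ⟨0, hn⟩ 1 : Fin n → ℂ) i‖ ^ 2 = 1
    rw [Finset.sum_eq_single ⟨0, hn⟩]
    · simp
    · intro i _ hi; simp [hi]
    · simp
  obtain ⟨e, he, hmin⟩ := (Metric.isCompact_of_isClosed_isBounded hclosed hbdd).exists_isMinOn hne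
    (((Metric.continuous_infDist_pt (strictUpper n)).comp continuous_compl).continuousOn)
  exact ⟨e, he, fun e' he' => hmin he'⟩

lemma exists_unitary_conj_eq_compl (hn : 0 < n) {Q N : Mat n} (hQ : IsProjOfRank n (n - 1) Q)
    (hN : IsNilpotent N) :
    ∃ W ∈ unitaryGroup (Fin n) ℂ, Wᴴ * N * W ∈ strictUpper n ∧
      ∃ e : Fin n → ℂ, ∑ i, ‖e i‖ ^ 2 = 1 ∧ Wᴴ * Q * W = compl e ∧
        ‖compl e - Wᴴ * N * W‖ = ‖Q - N‖ := by
  obtain ⟨W, hW, hT⟩ := exists_unitary_conj_mem_strictUpper hN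
  obtain ⟨e, he, hQe⟩ := (hQ.unitary_conj hW).exists_eq_compl hn
  refine ⟨W, hW, hT, e, he, hQe, ?_⟩
  rw [← hQe, ← norm_unitary_conj hW (Q - N), mul_sub, sub_mul]

/-- Triangularization turns every pair into a unit vector and a strictly upper triangular matrix, so
`ν` is a minimum over the compact unit sphere. -/
lemma exists_distT_eq_nu (hn : 0 < n) :
    ∃ e : Fin n → ℂ, ∑ i, ‖e i‖ ^ 2 = 1 ∧ distT n (compl e) = nu (n - 1) n ∧
      ∀ e' : Fin n → ℂ, ∑ i, ‖e' i‖ ^ 2 = 1 → nu (n - 1) n ≤ distT n (compl e') := by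
  obtain ⟨e, he, hmin⟩ := exists_minimal_pair hn
  have hleast : IsLeast {d : ℝ | ∃ P N : Mat n, IsProjOfRank n (n - 1) P ∧ IsNilpotent N ∧
      d = ‖P - N‖} (distT n (compl e)) := by
    constructor
    · obtain ⟨T, hT, hTd⟩ := exists_isNearest n (compl e)
      exact ⟨compl e, T, isProjOfRank_compl he, isNilpotent_of_mem_strictUpper hT, hTd.symm⟩
    · rintro d ⟨P, N, hP, hN, rfl⟩
      obtain ⟨W, -, hT, e', he', -, hnorm⟩ := exists_unitary_conj_eq_compl hn hP hN
      rw [← hnorm]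
      exact (hmin e' he').trans (distT_le hT)
  have hnu : nu (n - 1) n = distT n (compl e) := hleast.csInf_eq
  exact ⟨e, he, hnu.symm, fun e' he' => hnu ▸ hmin e' he'⟩

lemma nu_nonneg (r n : ℕ) : 0 ≤ nu r n :=
  Real.sInf_nonneg (by rintro d ⟨P, N, -, -, rfl⟩; exact norm_nonneg _)

lemma AgreesBelow.nu_le_norm (hn : 0 < n) {e : Fin n → ℂ} {A : Mat n} (hA : AgreesBelow e A)
    (he : ∑ i, ‖e i‖ ^ 2 = 1) : nu (n - 1) n ≤ ‖A‖ := by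
  obtain ⟨_, -, -, hle⟩ := exists_distT_eq_nu hn
  have := (hle e he).trans (distT_le hA.sub_mem)
  rwa [sub_sub_cancel] at this

lemma exists_norm_eq_nu (hn : 0 < n) :
    ∃ e : Fin n → ℂ, ∑ i, ‖e i‖ ^ 2 = 1 ∧ ∃ A : Mat n, AgreesBelow e A ∧ ‖A‖ = nu (n - 1) n := by
  obtain ⟨e, he, hd, -⟩ := exists_distT_eq_nu hn
  obtain ⟨T, hT, hTd⟩ := exists_isNearest n (compl e)
  exact ⟨e, he, _, agreesBelow_sub hT, hTd.trans hd⟩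

lemma half_le_nu_sq (hn : 2 ≤ n) : 1 / 2 ≤ nu (n - 1) n ^ 2 := by
  obtain ⟨e, he, A, hA, hAn⟩ := exists_norm_eq_nu (n := n) (by omega)
  exact hAn ▸ hA.half_le_norm_sq he hn

lemma nu_sq_lt (hn : 0 < n) {t : ℝ} (ht : 1 / 2 < t) (ht1 : t ≤ 1)
    (H : ∀ k < n, 0 ≤ aSeq t k ∧ aSeq t k < t) : nu (n - 1) n ^ 2 < t := by
  obtain ⟨s, hs, hst, hs'⟩ := exists_lt_forall_aSeq_lt ht H ht1
  obtain ⟨e, he, A, hA, hAs⟩ := exists_norm_sq_le_of_aSeq_lt hn hs.le (hst.trans_le ht1) hs'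
  exact ((pow_le_pow_left₀ (nu_nonneg _ _) (hA.nu_le_norm hn he) 2).trans hAs).trans_lt hst

/-- At `t = 1` the orbit is constantly `0`, so there is room to decrease `t`. -/
lemma nu_sq_lt_one (hn : 0 < n) : nu (n - 1) n ^ 2 < 1 :=
  nu_sq_lt hn (by norm_num) le_rfl fun k _ => by rw [aSeq_one]; norm_num

lemma nu_sq_gt_quarter (hn : 2 ≤ n) : 1 / 4 < nu (n - 1) n ^ 2 := by
  linarith [half_le_nu_sq hn]

lemma a_le (hn : 2 ≤ n) {k : ℕ} (hk : k < n) : a n k ≤ nu (n - 1) n ^ 2 := by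
  obtain ⟨e, he, A, hA, hAn⟩ := exists_norm_eq_nu (n := n) (by omega)
  have hb := hA.admissible he (nu_sq_gt_quarter hn) (by rw [hAn])
  exact (hb.aSeq_le (half_le_nu_sq hn) (nu_sq_lt_one (by omega)) k hk.le).2.trans
    (hb.le (half_le_nu_sq hn) hk)

lemma a_nonneg (hn : 2 ≤ n) {k : ℕ} (hk : k ≤ n) : 0 ≤ a n k :=
  aSeq_nonneg (half_le_nu_sq hn) (nu_sq_lt_one (by omega)) (fun _ h => a_le hn h) k hk

lemma a_lt_succ (hn : 2 ≤ n) {k : ℕ} (hk : k < n) : a n k < a n (k + 1) :=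
  aSeq_lt_succ (half_le_nu_sq hn) (nu_sq_lt_one (by omega)) (fun _ h => a_le hn h) hk

lemma hDen_a_pos (hn : 2 ≤ n) {k : ℕ} (hk : k < n) : 0 < hDen (nu (n - 1) n ^ 2) (a n k) :=
  hDen_pos (half_le_nu_sq hn) (a_nonneg hn hk.le) ((a_le hn hk).trans_lt (nu_sq_lt_one (by omega)))

/-- Otherwise the whole orbit lies strictly below `ν²`, and `nu_sq_lt` would give `ν² < ν²`. -/
lemma a_pred_last (hn : 2 ≤ n) : a n (n - 1) = nu (n - 1) n ^ 2 := by
  refine le_antisymm (a_le hn (by omega)) (not_lt.1 fun hlt => ?_)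
  have H : ∀ k < n, 0 ≤ a n k ∧ a n k < nu (n - 1) n ^ 2 := by
    intro k hk
    refine ⟨a_nonneg hn hk.le, ?_⟩
    by_cases hk' : k = n - 1
    · exact hk' ▸ hlt
    · exact (a_lt_succ hn hk).trans_le (a_le hn (by omega))
  have h0 := half_le_nu_sq hn
  -- Since `a_1 = 1 - ν²`, the assumption `a_1 < ν²` yields the strict bound `ν² > 1/2` needed for
  -- decreasing `t`.
  have h1 : a n 1 = 1 - nu (n - 1) n ^ 2 := by
    have : nu (n - 1) n ^ 2 ≠ 0 := by linarith
    have hd := hDen_a_pos hn (k := 0) (by omega)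
    rw [a, aSeq, h, aSeq, div_eq_iff (by exact hd.ne'), hDen]
    ring
  have h2 := (H 1 (by omega)).2
  exact lt_irrefl _ (nu_sq_lt (by omega) (by linarith) (nu_sq_lt_one (by omega)).le H)

/-! ### Optimal vectors and approximants -/

lemma AgreesBelow.headSum_eq (hn : 2 ≤ n) {e : Fin n → ℂ} {A : Mat n} (hA : AgreesBelow e A)
    (he : ∑ i, ‖e i‖ ^ 2 = 1) (hAn : ‖A‖ = nu (n - 1) n) : ∀ k ≤ n, headSum e k = a n k :=
  (hA.admissible he (nu_sq_gt_quarter hn) (by rw [hAn])).eq_aSeq (half_le_nu_sq hn)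
    (nu_sq_lt_one (by omega)) (by omega) (a_pred_last hn)

lemma a_last (hn : 2 ≤ n) : a n n = 1 := by
  obtain ⟨e, he, A, hA, hAn⟩ := exists_norm_eq_nu (n := n) (by omega)
  rw [← hA.headSum_eq hn he hAn n le_rfl, headSum_last, he]

lemma slack_eq_zero (hn : 2 ≤ n) {e : Fin n → ℂ} (hs : ∀ k ≤ n, headSum e k = a n k) (k : Fin n) :
    slack (nu (n - 1) n ^ 2) (headSum e k) (‖e k‖ ^ 2) = 0 := by
  have h1 := headSum_succ e k
  rw [hs _ k.2, hs _ k.2.le] at h1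
  rw [slack_eq_zero_iff (nu_sq_gt_quarter hn), hs _ k.2.le, ← sub_eq_of_eq_add' h1]
  exact h_sub_self (hDen_a_pos hn k.2).ne'

lemma exists_scaled_unitary (hn : 2 ≤ n) {e : Fin n → ℂ} (hs : ∀ k ≤ n, headSum e k = a n k) :
    ∃ A : Mat n, AgreesBelow e A ∧ Aᴴ * A = ((nu (n - 1) n ^ 2 : ℝ) : ℂ) • 1 ∧
      ‖A‖ = nu (n - 1) n := by
  have he : ∑ i, ‖e i‖ ^ 2 = 1 := by rw [← headSum_last, hs n le_rfl, a_last hn]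
  obtain ⟨A, hA, hAA⟩ := exists_orthogonal_cols he (nu_sq_gt_quarter hn)
    fun k _ => slack_eq_zero hn hs k
  simp only [slack_eq_zero hn hs, sub_zero] at hAA
  refine ⟨A, hA, ?_, le_antisymm ?_ (hA.nu_le_norm (by omega) he)⟩
  · rw [hAA, smul_one_eq_diagonal]
  · exact (sq_le_sq₀ (norm_nonneg _) (nu_nonneg _ _)).1
      (norm_sq_le_of_conjTranspose_mul_self (c := fun _ => nu (n - 1) n ^ 2) hAA
        (fun _ => le_rfl) (sq_nonneg _))

/-- Zero slack makes `A` times the test vector vanish above row `k`. This expresses the part of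
column `k` above the diagonal through the earlier columns, and induction on `k` applies. -/
lemma AgreesBelow.eq_of_norm_eq_nu (hn : 2 ≤ n) {e : Fin n → ℂ} {A B : Mat n}
    (hA : AgreesBelow e A) (hB : AgreesBelow e B) (he : ∑ i, ‖e i‖ ^ 2 = 1)
    (hAn : ‖A‖ = nu (n - 1) n) (hBn : ‖B‖ = nu (n - 1) n) : A = B := by
  have hs := hA.headSum_eq hn he hAn
  have htop : ∀ {C : Mat n}, AgreesBelow e C → ‖C‖ = nu (n - 1) n → ∀ k i : Fin n, i < k →
      C i k = star (e k) * coef (nu (n - 1) n ^ 2) (headSum e k) * (C *ᵥ head e k) i := by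
    intro C hC hCn k i hik
    have h1 := hC.sum_top_le_slack he (nu_sq_gt_quarter hn) (by rw [hCn]) k
    rw [slack_eq_zero hn hs k] at h1
    have h0 : ∀ i ∈ Finset.univ, 0 ≤ if i < k then
        ‖(C *ᵥ testVec e (nu (n - 1) n ^ 2) k) i‖ ^ 2 else 0 :=
      fun i _ => by split_ifs <;> positivity
    have h2 := (Finset.sum_eq_zero_iff_of_nonneg h0).1 (le_antisymm h1 (Finset.sum_nonneg h0)) i
      (Finset.mem_univ i)
    rw [if_pos hik, sq_eq_zero_iff, norm_eq_zero, testVec, mulVec_sub, mulVec_smul,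
      mulVec_single_one, Pi.sub_apply, Pi.smul_apply, sub_eq_zero] at h2
    exact h2
  have key : ∀ m : ℕ, ∀ k : Fin n, (k : ℕ) = m → ∀ i, A i k = B i k := by
    intro m
    induction m using Nat.strong_induction_on with
    | _ m ih =>
      rintro k rfl i
      rcases le_or_gt k i with hki | hik
      · rw [hA i k hki, hB i k hki]
      · rw [htop hA hAn k i hik, htop hB hBn k i hik]
        have hhead : (A *ᵥ head e k) i = (B *ᵥ head e k) i := by
          rw [mulVec, mulVec, dotProduct, dotProduct]
          refine Finset.sum_congr rfl fun j _ => ?_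
          unfold head
          split_ifs with hj
          · rw [ih j hj j rfl i]
          · simp
        rw [hhead]
  ext i k
  exact key k k rfl i

/-! ### The vectors `eVec n z` -/

lemma optQ_eq_compl (z : Fin n → ℂ) : optQ n z = compl (eVec n z) := rfl

lemma norm_eVec_sq (hn : 2 ≤ n) {z : Fin n → ℂ} (hz : ∀ i, ‖z i‖ = 1) (i : Fin n) :
    ‖eVec n z i‖ ^ 2 = a n (i + 1) - a n i := by
  rw [eVec, norm_mul, hz, one_mul, Complex.norm_real, Real.norm_eq_abs, sq_abs,
    Real.sq_sqrt (by linarith [a_lt_succ hn i.2])]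

lemma headSum_eVec (hn : 2 ≤ n) {z : Fin n → ℂ} (hz : ∀ i, ‖z i‖ = 1) :
    ∀ k ≤ n, headSum (eVec n z) k = a n k := by
  intro k
  induction k with
  | zero => intro _; exact headSum_zero _
  | succ k ih =>
    intro hk
    have h1 := headSum_succ (eVec n z) ⟨k, hk⟩
    rw [h1, ih (by omega), norm_eVec_sq hn hz]
    simp

lemma sum_norm_eVec_sq (hn : 2 ≤ n) {z : Fin n → ℂ} (hz : ∀ i, ‖z i‖ = 1) :
    ∑ i, ‖eVec n z i‖ ^ 2 = 1 := by
  rw [← headSum_last, headSum_eVec hn hz n le_rfl, a_last hn]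

lemma exists_eq_eVec (hn : 2 ≤ n) {e : Fin n → ℂ} (hs : ∀ k ≤ n, headSum e k = a n k) :
    ∃ z : Fin n → ℂ, (∀ i, ‖z i‖ = 1) ∧ e = eVec n z := by
  have hpos : ∀ i : Fin n, 0 < Real.sqrt (a n (i + 1) - a n i) := fun i =>
    Real.sqrt_pos.2 (by linarith [a_lt_succ hn i.2])
  refine ⟨fun i => e i / (Real.sqrt (a n (i + 1) - a n i) : ℂ), fun i => ?_, funext fun i => ?_⟩
  · have h1 := headSum_succ e i
    rw [hs _ i.2, hs _ i.2.le] at h1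
    rw [norm_div, Complex.norm_real, Real.norm_eq_abs, abs_of_pos (hpos i), h1,
      add_sub_cancel_left, Real.sqrt_sq (norm_nonneg _), div_self]
    have h2 := a_lt_succ hn i.2
    have h3 : 0 < ‖e i‖ ^ 2 := by
      rw [h1] at h2
      exact pos_of_lt_add_right h2
    exact fun h0 => by simp [h0] at h3
  · rw [eVec, div_mul_cancel₀]
    exact_mod_cast (hpos i).ne'

lemma distT_optQ (hn : 2 ≤ n) {z : Fin n → ℂ} (hz : ∀ i, ‖z i‖ = 1) :
    distT n (optQ n z) = nu (n - 1) n := by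
  obtain ⟨A, hA, -, hAn⟩ := exists_scaled_unitary hn (headSum_eVec hn hz)
  obtain ⟨T, hT, hTd⟩ := exists_isNearest n (optQ n z)
  refine le_antisymm ?_ ?_
  · rw [← hAn]
    have := distT_le (A := optQ n z) hA.sub_mem
    rwa [optQ_eq_compl, sub_sub_cancel] at this
  · rw [← hTd]
    exact (agreesBelow_sub hT).nu_le_norm (by omega) (sum_norm_eVec_sq hn hz)

lemma isNearest_optQ_iff (hn : 2 ≤ n) {z : Fin n → ℂ} (hz : ∀ i, ‖z i‖ = 1) {A : Mat n}
    (hA : AgreesBelow (eVec n z) A) (hAn : ‖A‖ = nu (n - 1) n) (T : Mat n) :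
    IsNearest n (optQ n z) T ↔ T = optQ n z - A := by
  constructor
  · rintro ⟨hT, hTd⟩
    rw [distT_optQ hn hz] at hTd
    rw [← (agreesBelow_sub hT).eq_of_norm_eq_nu hn hA (sum_norm_eVec_sq hn hz) hTd hAn,
      optQ_eq_compl, sub_sub_cancel]
  · rintro rfl
    exact ⟨hA.sub_mem, by rw [sub_sub_cancel, hAn, distT_optQ hn hz]⟩

lemma isClosestProj_iff (hn : 2 ≤ n) (Q : Mat n) :
    IsClosestProj n Q ↔ ∃ z : Fin n → ℂ, (∀ i, ‖z i‖ = 1) ∧ Q = optQ n z := by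
  obtain ⟨e₀, he₀, hd₀, hmin⟩ := exists_distT_eq_nu (n := n) (by omega)
  constructor
  · rintro ⟨hQ, hle⟩
    obtain ⟨e, he, rfl⟩ := hQ.exists_eq_compl (by omega)
    obtain ⟨T, hT, hTd⟩ := exists_isNearest n (compl e)
    have hnorm : ‖compl e - T‖ = nu (n - 1) n :=
      hTd.trans (le_antisymm (hd₀ ▸ hle _ (isProjOfRank_compl he₀)) (hmin e he))
    obtain ⟨z, hz, rfl⟩ := exists_eq_eVec hn ((agreesBelow_sub hT).headSum_eq hn he hnorm)
    exact ⟨z, hz, rfl⟩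
  · rintro ⟨z, hz, rfl⟩
    refine ⟨isProjOfRank_compl (sum_norm_eVec_sq hn hz), fun Q' hQ' => ?_⟩
    obtain ⟨e, he, rfl⟩ := hQ'.exists_eq_compl (by omega)
    rw [distT_optQ hn hz]
    exact hmin e he

/-! ### Unitary equivalence -/

lemma diagonal_mem_unitaryGroup {z : Fin n → ℂ} (hz : ∀ i, ‖z i‖ = 1) :
    diagonal z ∈ unitaryGroup (Fin n) ℂ := by
  rw [mem_unitaryGroup_iff, star_eq_conjTranspose, diagonal_conjTranspose, diagonal_mul_diagonal,
    ← diagonal_one]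
  congr 1
  ext i
  simp [Complex.mul_conj', hz i]

lemma diagonal_conj_apply (z : Fin n → ℂ) (A : Mat n) (i j : Fin n) :
    ((diagonal z)ᴴ * A * diagonal z) i j = star (z i) * A i j * z j := by
  rw [diagonal_conjTranspose, mul_diagonal, diagonal_mul, Pi.star_apply]

lemma diagonal_conj_compl_eVec {z : Fin n → ℂ} (hz : ∀ i, ‖z i‖ = 1) :
    (diagonal z)ᴴ * compl (eVec n z) * diagonal z = compl (eVec n 1) := by
  have hzz : ∀ i, star (z i) * z i = 1 := fun i => by
    rw [RCLike.star_def, Complex.conj_mul', hz i]; simp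
  ext i j
  rw [diagonal_conj_apply, compl_apply, compl_apply, eVec, eVec, eVec, eVec, star_mul', star_mul']
  by_cases hij : i = j
  · subst hij
    simp only [if_true, Pi.one_apply, star_one]
    linear_combination (1 - (Real.sqrt (a n (i + 1) - a n i) : ℂ) *
      star (Real.sqrt (a n (i + 1) - a n i) : ℂ) * (1 + star (z i) * z i)) * hzz i
  · simp only [if_neg hij, Pi.one_apply, star_one]
    linear_combination (-(Real.sqrt (a n (i + 1) - a n i) : ℂ) *
      star (Real.sqrt (a n (j + 1) - a n j) : ℂ)) * (star (z j) * z j * hzz i + hzz j)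

/-- Canonical form of a closest pair: a Schur unitary makes `N` strictly upper triangular, a
diagonal unitary removes the phases of `e` while preserving triangularity, and uniqueness of the
nearest point identifies the image of `N`. -/
lemma IsClosestPair.exists_unitary_conj (hn : 2 ≤ n) {Q N T : Mat n} (hQN : IsClosestPair n Q N)
    (hT : IsNearest n (optQ n 1) T) :
    ∃ V ∈ unitaryGroup (Fin n) ℂ, Vᴴ * Q * V = optQ n 1 ∧ Vᴴ * N * V = T := by
  obtain ⟨hQ, hN, hd⟩ := hQN
  obtain ⟨W, hW, hS, e, he, hQe, hnorm⟩ := exists_unitary_conj_eq_compl (by omega) hQ hN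
  rw [hd] at hnorm
  obtain ⟨z, hz, rfl⟩ := exists_eq_eVec hn ((agreesBelow_sub hS).headSum_eq hn he hnorm)
  have h1 : ∀ i : Fin n, ‖(1 : Fin n → ℂ) i‖ = 1 := fun i => by simp
  have hD := diagonal_mem_unitaryGroup hz
  have hcompl := diagonal_conj_compl_eVec hz
  set D : Mat n := diagonal z with hDdef
  refine ⟨W * D, mul_mem hW hD, ?_, ?_⟩
  · rw [optQ_eq_compl, ← hcompl, ← hQe, conjTranspose_mul]
    simp only [mul_assoc]
  · have hS' : Dᴴ * (Wᴴ * N * W) * D ∈ strictUpper n := fun i j hij => by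
      rw [hDdef, diagonal_conj_apply, hS i j hij, mul_zero, zero_mul]
    have hnear : IsNearest n (optQ n 1) (Dᴴ * (Wᴴ * N * W) * D) := by
      refine ⟨hS', ?_⟩
      rw [distT_optQ hn h1, ← hnorm, optQ_eq_compl, ← hcompl, ← sub_mul, ← mul_sub,
        norm_unitary_conj hD]
    have hA := agreesBelow_sub (e := eVec n 1) hT.1
    have hAn := hT.2.trans (distT_optQ hn h1)
    rw [(isNearest_optQ_iff hn h1 hA hAn _).1 hT, ← (isNearest_optQ_iff hn h1 hA hAn _).1 hnear,
      conjTranspose_mul]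
    simp only [mul_assoc]

lemma IsClosestPair.unitarily_equivalent (hn : 2 ≤ n) {Q N Q' N' : Mat n}
    (hQN : IsClosestPair n Q N) (hQN' : IsClosestPair n Q' N') :
    ∃ V ∈ unitaryGroup (Fin n) ℂ, Q' = Vᴴ * Q * V ∧ N' = Vᴴ * N * V := by
  obtain ⟨T, hT⟩ := exists_isNearest n (optQ n 1)
  obtain ⟨V, hV, hQ, hN⟩ := hQN.exists_unitary_conj hn hT
  obtain ⟨V', hV', hQ', hN'⟩ := hQN'.exists_unitary_conj hn hT
  have h1 : V' * V'ᴴ = 1 := mem_unitaryGroup_iff.1 hV'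
  have key : ∀ {X Y : Mat n}, Vᴴ * X * V = V'ᴴ * Y * V' →
      Y = (V * V'ᴴ)ᴴ * X * (V * V'ᴴ) := by
    intro X Y hXY
    calc Y = V' * V'ᴴ * Y * (V' * V'ᴴ) := by rw [h1, one_mul, mul_one]
      _ = V' * (V'ᴴ * Y * V') * V'ᴴ := by simp only [mul_assoc]
      _ = (V * V'ᴴ)ᴴ * X * (V * V'ᴴ) := by
        rw [← hXY, conjTranspose_mul, conjTranspose_conjTranspose]
        simp only [mul_assoc]
  exact ⟨V * V'ᴴ, mul_mem hV (conjTranspose_mem_unitaryGroup hV'),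
    key (hQ.trans hQ'.symm), key (hN.trans hN'.symm)⟩

/-! ### Column equations and the unitary factor -/

lemma col_eq_iff_of_isNearest (hn : 2 ≤ n) {z : Fin n → ℂ} (hz : ∀ i, ‖z i‖ = 1) {T : Mat n}
    (hT : T ∈ strictUpper n)
    (hAA : (optQ n z - T)ᴴ * (optQ n z - T) = ((nu (n - 1) n ^ 2 : ℝ) : ℂ) • 1) {k : Fin n}
    {v : Fin n → ℂ} (hv : ∀ i, k ≤ i → v i = 0) :
    (∀ j, j < k → ((optQ n z).col j - T.col j) ⬝ᵥ star ((optQ n z).col k - v) = 0) ↔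
      v = T.col k := by
  have horth : ∀ j < k,
      ((optQ n z).col j - T.col j) ⬝ᵥ star ((optQ n z).col k - T.col k) = 0 := by
    intro j hj
    have h1 := congrFun (congrFun hAA k) j
    rw [Matrix.smul_apply, one_apply_ne hj.ne', smul_zero] at h1
    rw [dotProduct_comm]
    exact h1
  constructor
  -- Subtracting the two systems, `v - t_k` is supported above row `k` and orthogonal to all earlier
  -- columns of `Q - T`, hence zero.
  · intro H
    have hy := (agreesBelow_sub (e := eVec n z) hT).eq_zero_of_orthogonal (sum_norm_eVec_sq hn hz)
      (nu_sq_gt_quarter hn) hAA (k := k) (y := v - T.col k)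
      (fun i hi => by
        rw [Pi.sub_apply, hv i (Fin.le_def.2 hi), col_apply, hT i k (Fin.le_def.2 hi), sub_zero])
      (fun j hj => by
        have h1 := horth j hj
        have h2 := H j hj
        have h3 : v - T.col k = ((optQ n z).col k - T.col k) - ((optQ n z).col k - v) := by abel
        rw [h3, star_sub, dotProduct_sub]
        exact sub_eq_zero.2 (h1.trans h2.symm))
    exact sub_eq_zero.1 hy
  · rintro rfl
    exact horth

lemma exists_unitary_of_conjTranspose_mul_self {A : Mat n} {r : ℝ} (hr : r ≠ 0)
    (hAA : Aᴴ * A = ((r ^ 2 : ℝ) : ℂ) • 1) :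
    ∃ U ∈ unitaryGroup (Fin n) ℂ, A = (r : ℂ) • U := by
  have hr' : (r : ℂ) ≠ 0 := by exact_mod_cast hr
  refine ⟨(r : ℂ)⁻¹ • A, ?_, by rw [smul_smul, mul_inv_cancel₀ hr', one_smul]⟩
  rw [mem_unitaryGroup_iff', star_eq_conjTranspose, conjTranspose_smul, smul_mul_smul_comm, hAA,
    smul_smul]
  have : star (r : ℂ)⁻¹ * (r : ℂ)⁻¹ * ((r ^ 2 : ℝ) : ℂ) = 1 := by
    rw [star_inv₀, RCLike.star_def, Complex.conj_ofReal]
    push_cast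
    field_simp
  rw [this, one_smul]

end ProjNil
theorem theorem4p2 (n : ℕ) (hn : 2 ≤ n) :
    -- the recursion divides by no zero and the square roots are of nonnegative numbers
    (∀ k : ℕ, k < n →
      ProjNil.hDen (ProjNil.nu (n - 1) n ^ 2) (ProjNil.a n k) ≠ 0 ∧
        ProjNil.a n k ≤ ProjNil.a n (k + 1)) ∧
    -- (i)
    (∀ z : Fin n → ℂ, (∀ i, ‖z i‖ = 1) →
      ProjNil.IsProjOfRank n (n - 1) (ProjNil.optQ n z) ∧
        ProjNil.distT n (ProjNil.optQ n z) = ProjNil.nu (n - 1) n) ∧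
    (∀ Q : ProjNil.Mat n, ProjNil.IsClosestProj n Q ↔
      ∃ z : Fin n → ℂ, (∀ i, ‖z i‖ = 1) ∧ Q = ProjNil.optQ n z) ∧
    -- (ii)
    (∀ z : Fin n → ℂ, (∀ i, ‖z i‖ = 1) →
      (∃! T : ProjNil.Mat n, ProjNil.IsNearest n (ProjNil.optQ n z) T) ∧
      ∀ T : ProjNil.Mat n, ProjNil.IsNearest n (ProjNil.optQ n z) T →
        (∃ U ∈ Matrix.unitaryGroup (Fin n) ℂ,
          ProjNil.optQ n z - T = (ProjNil.nu (n - 1) n : ℂ) • U) ∧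
        -- given the columns of `T` before the `k`-th, the `k`-th one is the unique solution,
        -- supported above the diagonal, of the orthogonality equations
        ∀ (k : Fin n) (v : Fin n → ℂ), (∀ i, k ≤ i → v i = 0) →
          ((∀ j, j < k →
              ((ProjNil.optQ n z).col j - T.col j) ⬝ᵥ star ((ProjNil.optQ n z).col k - v) = 0) ↔
            v = T.col k)) ∧
    -- any two closest projection-nilpotent pairs are unitarily equivalent
    (∀ Q N Q' N' : ProjNil.Mat n,
      ProjNil.IsClosestPair n Q N → ProjNil.IsClosestPair n Q' N' →
        ∃ V ∈ Matrix.unitaryGroup (Fin n) ℂ, Q' = Vᴴ * Q * V ∧ N' = Vᴴ * N * V) := by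
  refine ⟨fun k hk => ⟨(ProjNil.hDen_a_pos hn hk).ne', (ProjNil.a_lt_succ hn hk).le⟩,
    fun z hz => ⟨ProjNil.isProjOfRank_compl (ProjNil.sum_norm_eVec_sq hn hz),
      ProjNil.distT_optQ hn hz⟩,
    ProjNil.isClosestProj_iff hn, fun z hz => ?_,
    fun Q N Q' N' hQN hQN' => hQN.unitarily_equivalent hn hQN'⟩
  obtain ⟨A, hA, hAA, hAn⟩ := ProjNil.exists_scaled_unitary hn (ProjNil.headSum_eVec hn hz)
  have hnear := ProjNil.isNearest_optQ_iff hn hz hA hAn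
  refine ⟨⟨_, (hnear _).2 rfl, fun T hT => (hnear T).1 hT⟩, fun T hT => ?_⟩
  have hTA : ProjNil.optQ n z - T = A := by rw [(hnear T).1 hT, sub_sub_cancel]
  have hnu : ProjNil.nu (n - 1) n ≠ 0 := by
    intro h0
    have := ProjNil.half_le_nu_sq hn
    rw [h0] at this
    norm_num at this
  rw [← hTA] at hAA
  exact ⟨ProjNil.exists_unitary_of_conjTranspose_mul_self hnu hAA,
    fun k v hv => ProjNil.col_eq_iff_of_isNearest hn hz hT.1 hAA hv⟩
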